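/- Let $m\ge 2$ be an even integer and let $$u_m(t,x)=\frac1{2\pi}\int_{\mathbb R}e^{-i\alpha x-\alpha^m t}\,d\alpha ,\qquad t>0,\ x\in\mathbb R,$$ be the fundamental solution of the heat-type equation $\partial_t u=(-1)^{m/2+1}\partial_x^m u$. Let $\eta(x)$, $x\in\mathbb R$, be a real-valued jointly measurable Gaussian process on a probability space, with mean $M(x)=\mathbb E\eta(x)$ such that $y\mapsto M(x-y)u_m(t,y)$ is integrable for all $t>0$, $x\in\mathbb R$, and with covariance function $$\mathrm{Cov}(\eta(y),\eta(y+x))=\sum_{j=1}^n A_j\frac{\cos(w_jx)}{(1+x^2)^{\kappa_j/2}},\qquad x,y\in\mathbb R,$$ where $\sum_{j=1}^nA_j=1$, $w_j\ne0$ and $\kappa_j\in(0,1)$ for all $j$. For $t>0$, $x\in\mathbb R$ let $$u(t,x)=\int_{\mathbb R}\eta(x-y)\,u_m(t,y)\,dy ,$$ an integral that converges absolutely almost surely and defines an integrable random variable, and for $\varepsilon>0$ let $$U_\varepsilon(t,x)=\varepsilon^{-1/4}\left(u\left(\frac{t}{\sqrt{\varepsilon^m}},\frac{x}{\sqrt\varepsilon}\right)-\mathbb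 E\,u\left(\frac{t}{\sqrt{\varepsilon^m}},\frac{x}{\sqrt\varepsilon}\right)\right).$$ Put $$\sigma=\sum_{j=1}^n c_1(\kappa_j)A_jK_{\frac{\kappa_j-1}2}(|w_j|)\,|w_j|^{\frac{\kappa_j-1}2},\qquad c_1(\kappa)=\frac{2^{(1-\kappa)/2}}{\sqrt\pi\,\Gamma(\kappa/2)},\qquad K_\nu(z)=\frac12\int_0^\infty s^{\nu-1}e^{-\frac z2\left(s+\frac1s\right)}ds ,$$ and let $W$ be a complex Gaussian white noise random measure on $\mathbb R$ that is symmetric around the origin (that is, the family $W(A)$, over Borel sets $A$ of finite Lebesgue measure, is centred and jointly Gaussian, with $\mathbb E\,W(A)\overline{W(B)}=|A\cap B|$ and $W(-A)=\overline{W(A)}$ almost surely). Then, as $\varepsilon\to0^+$, the finite-dimensional distributions of $U_\varepsilon(t,x)$, $t>0$, $x\in\mathbb R$, converge weakly to those of the zero-mean real-valued Gaussian random field $$U_0(t,x)=\sqrt{\sigma}\int_{\mathbb R}e^{i\lambda x-\lambda^mt}\,W(d\lambda),\qquad t>0,\ x\in\mathbb R,$$ where the integral exists in the $L_2(\Omega)$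 sense, and for $t,t'>0$, $x,x'\in\mathbb R$ $$\mathrm{Cov}(U_0(t,x),U_0(t',x'))=\sigma\int_{\mathbb R}\cos(\lambda(x-x'))e^{-(t+t')\lambda^m}d\lambda =\sigma\,\frac{2\sqrt\pi}{m(t+t')^{1/m}}\;{}_1\Psi_1\!\left[\begin{array}{c}(1/m,2/m)\\(1/2,1)\end{array};\,-\frac{(x-x')^2}{4(t+t')^{2/m}}\right],$$ where ${}_1\Psi_1\!\left[\begin{array}{c}(a,\alpha)\\(b,\beta)\end{array};z\right]=\sum_{l=0}^\infty\frac{\Gamma(a+\alpha l)}{\Gamma(b+\beta l)}\frac{z^l}{l!}$ is the Fox–Wright function, whose series converges here. -/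

import Mathlib

open MeasureTheory ProbabilityTheory Filter Topology
open scoped ENNReal

noncomputable section

namespace HighOrderHeat

/-- Modified Bessel function of the second kind,
`K_ν(z) = (1/2) ∫₀^∞ s^(ν-1) exp(-(z/2)(s + 1/s)) ds`, for `z > 0`. -/
def besselK (ν z : ℝ) : ℝ :=
  (1 / 2) * ∫ s in Set.Ioi (0 : ℝ), s ^ (ν - 1) * Real.exp (-(1 / 2) * (s + 1 / s) * z)

/-- The constant `c₁(κ) = 2^((1-κ)/2) / (√π Γ(κ/2))`. -/
def c₁ (κ : ℝ) : ℝ :=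
  (2 : ℝ) ^ ((1 - κ) / 2) / (√Real.pi * Real.Gamma (κ / 2))

/-- The general term of the Fox–Wright series `ₚΨ_q[(a_j, A_j); (b_k, B_k); z]`. -/
def foxWrightTerm {p q : ℕ} (a A : Fin p → ℝ) (b B : Fin q → ℝ) (z : ℝ) (n : ℕ) : ℝ :=
  (∏ j, Real.Gamma (a j + A j * n)) / (∏ k, Real.Gamma (b k + B k * n)) *
    (z ^ n / (n.factorial : ℝ))

/-- The Fox–Wright generalized hypergeometric function `ₚΨ_q`. -/
def foxWright {p q : ℕ} (a A : Fin p → ℝ) (b B : Fin q → ℝ) (z : ℝ) : ℝ :=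
  ∑' n : ℕ, foxWrightTerm a A b B z n

/-- Covariance function `r(x) = ∑_j A_j cos(w_j x) / (1 + x²)^(κ_j/2)`. -/
def cyclicCov {n : ℕ} (κ w A : Fin n → ℝ) (x : ℝ) : ℝ :=
  ∑ j, Real.cos (w j * x) / (1 + x ^ 2) ^ (κ j / 2) * A j

/-- The constant `∑_j c₁(κ_j) A_j K_{(κ_j-1)/2}(|w_j|) |w_j|^((κ_j-1)/2)`
(the value at zero of the spectral density of `cyclicCov κ w A`). -/
def spectralAtZero {n : ℕ} (κ w A : Fin n → ℝ) : ℝ :=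
  ∑ j, c₁ (κ j) * A j * besselK ((κ j - 1) / 2) |w j| * |w j| ^ ((κ j - 1) / 2)

/-- Fundamental solution `u_m(t,x) = (1/2π) ∫ exp(-iαx - α^m t) dα` of the even-order heat equation
`∂u/∂t = (-1)^(m/2+1) ∂^m u/∂x^m`.  The integral is a real number as `m` is even. -/
def heatKernel (m : ℕ) (t x : ℝ) : ℝ :=
  ((1 / (2 * Real.pi) : ℂ) *
    ∫ α : ℝ, Complex.exp (-Complex.I * (α : ℂ) * (x : ℂ) - (α : ℂ) ^ m * (t : ℂ))).re

section Probability

variable {Ω : Type*} [MeasurableSpace Ω]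

/-- The solution field `u(t,x) = ∫ η(x-y) u_m(t,y) dy` with initial condition `η`. -/
def solution (m : ℕ) (η : ℝ → Ω → ℝ) (t x : ℝ) (ω : Ω) : ℝ :=
  ∫ y : ℝ, η (x - y) ω * heatKernel m t y

/-- The rescaled centred field
`U_ε(t,x) = ε^(-1/4) (u(t/√(ε^m), x/√ε) - E u(t/√(ε^m), x/√ε))`. -/
def rescaled (m : ℕ) (η : ℝ → Ω → ℝ) (P : Measure Ω) (ε t x : ℝ) (ω : Ω) : ℝ :=
  ε ^ (-(1 / 4) : ℝ) *
    (solution m η (t / √(ε ^ m)) (x / √ε) ω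
      - ∫ ω', solution m η (t / √(ε ^ m)) (x / √ε) ω' ∂P)

/-- `W` is a complex Gaussian white noise random measure on `ℝ` (with Lebesgue control measure)
that is symmetric around the origin: `(W(A))_A`, over Borel sets of finite Lebesgue measure,
is a centred jointly Gaussian family with `E[W(A) conj W(B)] = |A ∩ B|` and `W(-A) = conj W(A)`.
Only the values on Borel sets of finite measure are meaningful.  Finite (and, in mean square,
countable) additivity is a consequence of the covariance structure. -/
structure IsSymmetricWhiteNoise (W : Set ℝ → Ω → ℂ) (P : Measure Ω) : Prop where
  gaussian : IsGaussianProcess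
    (fun (A : {A : Set ℝ // MeasurableSet A ∧ volume A < ∞}) (ω : Ω) => W A.1 ω) P
  mean_zero : ∀ A : Set ℝ, MeasurableSet A → volume A < ∞ → ∫ ω, W A ω ∂P = 0
  covariance : ∀ A B : Set ℝ, MeasurableSet A → volume A < ∞ → MeasurableSet B → volume B < ∞ →
    ∫ ω, W A ω * (starRingEnd ℂ) (W B ω) ∂P = ((volume.real (A ∩ B) : ℝ) : ℂ)
  symmetric : ∀ A : Set ℝ, MeasurableSet A → volume A < ∞ →
    ∀ᵐ ω ∂P, W ((fun x : ℝ => -x) ⁻¹' A) ω = (starRingEnd ℂ) (W A ω)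

/-- The integral of a simple function with respect to `W`: `∑_z z W({s = z})`. -/
def simpleStochInt (W : Set ℝ → Ω → ℂ) (s : SimpleFunc ℝ ℂ) (ω : Ω) : ℂ :=
  ∑ z ∈ s.range, z * W (s ⁻¹' {z}) ω

/-- `X = ∫ g(λ) W(dλ)` in the `L²(Ω)` sense: `X` is the mean-square limit of the integrals of
square integrable simple functions that converge to `g` in `L²(ℝ)`. -/
def IsStochInt (W : Set ℝ → Ω → ℂ) (P : Measure Ω) (g : ℝ → ℂ) (X : Ω → ℂ) : Prop :=
  AEStronglyMeasurable X P ∧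
  ∃ s : ℕ → SimpleFunc ℝ ℂ, (∀ n, MemLp (s n) 2 volume) ∧
    Tendsto (fun n => eLpNorm (fun l : ℝ => s n l - g l) 2 volume) atTop (𝓝 0) ∧
    Tendsto (fun n => eLpNorm (fun ω => simpleStochInt W (s n) ω - X ω) 2 P) atTop (𝓝 0)

open Classical in
/-- (A version of) the stochastic integral `∫ g(λ) W(dλ)`; zero if it does not exist. -/
def stochInt (W : Set ℝ → Ω → ℂ) (P : Measure Ω) (g : ℝ → ℂ) : Ω → ℂ :=
  if h : ∃ X, IsStochInt W P g X then h.choose else 0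

/-- The integrand `λ ↦ exp(iλx - λ^m t)`. -/
def limitKernel (m : ℕ) (t x : ℝ) (l : ℝ) : ℂ :=
  Complex.exp (Complex.I * (l : ℂ) * (x : ℂ) - (l : ℂ) ^ m * (t : ℂ))

/-- The field `√σ ∫ exp(iλx - λ^m t) W(dλ)`; the integral is almost surely real. -/
def limitField (m : ℕ) (σ : ℝ) (W : Set ℝ → Ω → ℂ) (P : Measure Ω) (t x : ℝ) (ω : Ω) : ℝ :=
  √σ * (stochInt W P (limitKernel m t x) ω).re

end Probability

end HighOrderHeat

end

open HighOrderHeat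

/-! The argument is spectral. Each `(1 + x²)^(-κ/2)` is a Gamma mixture of the Gaussians `exp(-s
x²)`, hence the Fourier transform of an integrable density. Multiplying by `cos (w x)` splits this
density into halves shifted by `±w`. So the covariance of `η` has an integrable density `f =
spectralDensity κ w A`, possibly singular only at the points `±w_j`. It is therefore continuous at
`0`, where its value is the Bessel expression for `σ` (`integral_exp_mul_spectralDensity`,
`continuousAt_spectralDensity_zero`, `spectralDensity_zero`).

Since `heatKernel m t` has Fourier transform `exp(-t λ^m)`, the solution has covariance `∫
cos((x'-x)λ) exp(-(t+t')λ^m) f(λ) dλ` (`integral_heatKernel_mul_heatKernel`). With `c = ε^(-1/2)`,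
the rescaling turns this into `c ∫ cos((x'-x)cλ) exp(-(t+t')(cλ)^m) f(λ) dλ`. This is an approximate
identity tested against `f`, so it tends to `f 0` times the integral of the profile
(`tendsto_scaled_integral`, `tendsto_cov_rescaled`).

Everything stays in Gaussian subspaces of `L²`. The pathwise solution, once centred, is a.s. a
Bochner integral in the closed span of the centred initial data (`integral_ae_eq_convolution`), and
the limit field lies in the closed span of the real and imaginary parts of the noise. Such spans
consist of centred Gaussian variables and are jointly Gaussian, so convergence of covariances gives
convergence in law through characteristic functions (`tendstoInDistribution_of_tendsto_cov`).

The covariance of the limit comes from the isometry of the stochastic integral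
(`inner_of_isStochInt`), together with the reality forced by the symmetry of the noise. Its
Fox–Wright form comes from integrating the cosine series term by term. -/

namespace HighOrderHeat

/-! ### The fundamental solution: integrability and Fourier transform. -/

section HeatKernel

open scoped FourierTransform

variable {m : ℕ} {t : ℝ}

lemma sq_sub_one_le_pow (hm : Even m) (hm0 : 0 < m) (a : ℝ) : a ^ 2 - 1 ≤ a ^ m := by
  obtain ⟨k, rfl⟩ := hm
  have hk : 1 ≤ k := by omega
  rw [← two_mul, pow_mul]
  rcases le_or_gt 1 (a ^ 2) with h1 | h1
  · have := le_self_pow₀ h1 (by omega : k ≠ 0)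
    linarith
  · have : 0 ≤ (a ^ 2) ^ k := by positivity
    linarith

/-- Reduces integrability and decay questions for every even order to the Gaussian case, at the
price of the constant `exp t`. -/
lemma exp_neg_mul_pow_le (hm : Even m) (hm0 : 0 < m) (ht : 0 < t) (a : ℝ) :
    Real.exp (-t * a ^ m) ≤ Real.exp t * Real.exp (-t * a ^ 2) := by
  rw [← Real.exp_add]
  apply Real.exp_le_exp.2
  nlinarith [sq_sub_one_le_pow hm hm0 a]

lemma integrable_pow_mul_exp_neg_mul_pow (hm : Even m) (hm0 : 0 < m) (ht : 0 < t)
    (k : ℕ) : Integrable (fun a : ℝ => a ^ k * Real.exp (-t * a ^ m)) := by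
  have h := integrable_rpow_mul_exp_neg_mul_sq ht (s := k)
    (lt_of_lt_of_le (by norm_num) (Nat.cast_nonneg k))
  refine (h.norm.const_mul (Real.exp t)).mono' (by fun_prop) (ae_of_all _ fun a => ?_)
  simp only [Real.rpow_natCast, norm_mul, Real.norm_eq_abs, Real.abs_exp]
  calc _ ≤ |a ^ k| * (Real.exp t * Real.exp (-t * a ^ 2)) := by
        gcongr; exact exp_neg_mul_pow_le hm hm0 ht a
    _ = _ := by ring

lemma integrable_exp_neg_mul_pow (hm : Even m) (hm0 : 0 < m) (ht : 0 < t) :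
    Integrable (fun a : ℝ => Real.exp (-t * a ^ m)) := by
  simpa using integrable_pow_mul_exp_neg_mul_pow hm hm0 ht 0

/-- The Fourier symbol `α ↦ exp(-t α^m)` of the heat-type semigroup. -/
noncomputable def heatSymbol (m : ℕ) (t a : ℝ) : ℂ := ((Real.exp (-t * a ^ m) : ℝ) : ℂ)

lemma continuous_heatSymbol : Continuous (heatSymbol m t) := by
  unfold heatSymbol; fun_prop

lemma integrable_heatSymbol (hm : Even m) (hm0 : 0 < m) (ht : 0 < t) :
    Integrable (heatSymbol m t) :=
  (integrable_exp_neg_mul_pow hm hm0 ht).ofReal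

lemma hasDerivAt_heatSymbol (a : ℝ) :
    HasDerivAt (heatSymbol m t)
      (((-t * m * (a ^ (m - 1) * Real.exp (-t * a ^ m)) : ℝ)) : ℂ) a := by
  have h : HasDerivAt (fun a : ℝ => Real.exp (-t * a ^ m))
      (Real.exp (-t * a ^ m) * (-t * (m * a ^ (m - 1)))) a :=
    ((hasDerivAt_pow m a).const_mul (-t)).exp
  convert! h.ofReal_comp using 2
  ring

lemma hasDerivAt_deriv_heatSymbol (a : ℝ) :
    HasDerivAt (deriv (heatSymbol m t))
      (((-t * m * ((m - 1 : ℕ) * (a ^ (m - 1 - 1) * Real.exp (-t * a ^ m)) -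
        t * m * (a ^ (m - 1 + (m - 1)) * Real.exp (-t * a ^ m))) : ℝ)) : ℂ) a := by
  have h0 : deriv (heatSymbol m t) =
      fun a : ℝ => (((-t * m * (a ^ (m - 1) * Real.exp (-t * a ^ m)) : ℝ)) : ℂ) :=
    funext fun a => (hasDerivAt_heatSymbol a).deriv
  rw [h0]
  have h : HasDerivAt (fun a : ℝ => Real.exp (-t * a ^ m))
      (Real.exp (-t * a ^ m) * (-t * (m * a ^ (m - 1)))) a :=
    ((hasDerivAt_pow m a).const_mul (-t)).exp
  have h1 := (((hasDerivAt_pow (m - 1) a).mul h).const_mul (-t * m)).ofReal_comp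
  convert! h1 using 2
  rw [pow_add]
  ring

/-- Two integrable derivatives of the symbol give decay of order `x⁻²` of its transform. This is the
source of integrability of the kernel, which need not be positive for `m > 2`. -/
lemma norm_fourier_heatSymbol_le (hm : Even m) (hm0 : 0 < m) (ht : 0 < t) :
    ∃ C : ℝ, ∀ x : ℝ, ‖𝓕 (heatSymbol m t) x‖ ≤ C * (1 + x ^ 2)⁻¹ := by
  have hint := integrable_heatSymbol hm hm0 ht
  have hd1 : Differentiable ℝ (heatSymbol m t) := fun a =>
    (hasDerivAt_heatSymbol a).differentiableAt
  have hd2 : Differentiable ℝ (deriv (heatSymbol m t)) := fun a =>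
    (hasDerivAt_deriv_heatSymbol a).differentiableAt
  have hi1 : Integrable (deriv (heatSymbol m t)) := by
    rw [funext fun a => (hasDerivAt_heatSymbol (m := m) (t := t) a).deriv]
    exact ((integrable_pow_mul_exp_neg_mul_pow hm hm0 ht _).const_mul _).ofReal
  have hi2 : Integrable (deriv (deriv (heatSymbol m t))) := by
    rw [funext fun a => (hasDerivAt_deriv_heatSymbol (m := m) (t := t) a).deriv]
    exact ((((integrable_pow_mul_exp_neg_mul_pow hm hm0 ht _).const_mul _).sub
      ((integrable_pow_mul_exp_neg_mul_pow hm hm0 ht _).const_mul _)).const_mul _).ofReal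
  have key (x : ℝ) : 𝓕 (deriv (deriv (heatSymbol m t))) x =
      (2 * Real.pi * Complex.I * x) ^ 2 * 𝓕 (heatSymbol m t) x := by
    rw [Real.fourier_deriv hi1 hd2 hi2, Real.fourier_deriv hint hd1 hi1]
    simp only [smul_eq_mul]; ring
  have bd (f : ℝ → ℂ) (x : ℝ) : ‖𝓕 f x‖ ≤ ∫ a, ‖f a‖ :=
    VectorFourier.norm_fourierIntegral_le_integral_norm _ _ _ f x
  refine ⟨(∫ a, ‖heatSymbol m t a‖) + ∫ a, ‖deriv (deriv (heatSymbol m t)) a‖, fun x => ?_⟩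
  rw [← div_eq_mul_inv, le_div_iff₀ (by positivity)]
  have h0 := bd (heatSymbol m t) x
  have h2 := bd (deriv (deriv (heatSymbol m t))) x
  rw [key, norm_mul] at h2
  have hn : ‖(2 * Real.pi * Complex.I * x : ℂ) ^ 2‖ = (2 * Real.pi) ^ 2 * x ^ 2 := by
    simp [mul_pow, abs_of_pos Real.pi_pos]
  rw [hn] at h2
  have hpi : 1 ≤ (2 * Real.pi) ^ 2 := by nlinarith [Real.pi_gt_three]
  have hx : x ^ 2 * ‖𝓕 (heatSymbol m t) x‖ ≤
      (2 * Real.pi) ^ 2 * x ^ 2 * ‖𝓕 (heatSymbol m t) x‖ := by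
    rw [mul_assoc]
    exact le_mul_of_one_le_left (by positivity) hpi
  linarith

lemma continuous_fourier_heatSymbol (hm : Even m) (hm0 : 0 < m) (ht : 0 < t) :
    Continuous (𝓕 (heatSymbol m t)) :=
  VectorFourier.fourierIntegral_continuous Real.continuous_fourierChar
    (by fun_prop) (integrable_heatSymbol hm hm0 ht)

lemma integrable_fourier_heatSymbol (hm : Even m) (hm0 : 0 < m) (ht : 0 < t) :
    Integrable (𝓕 (heatSymbol m t)) := by
  obtain ⟨C, hC⟩ := norm_fourier_heatSymbol_le hm hm0 ht
  exact (integrable_inv_one_add_sq.const_mul C).mono'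
    (continuous_fourier_heatSymbol hm hm0 ht).aestronglyMeasurable (ae_of_all _ hC)

lemma integral_exp_eq_fourier_heatSymbol (x : ℝ) :
    ∫ α : ℝ, Complex.exp (-Complex.I * (α : ℂ) * (x : ℂ) - (α : ℂ) ^ m * (t : ℂ)) =
      𝓕 (heatSymbol m t) (x / (2 * Real.pi)) := by
  rw [Real.fourier_real_eq_integral_exp_smul]
  refine integral_congr_ae (ae_of_all _ fun a => ?_)
  simp only [heatSymbol, smul_eq_mul, Complex.ofReal_exp, ← Complex.exp_add]
  congr 1
  have : (Real.pi : ℂ) ≠ 0 := by exact_mod_cast Real.pi_ne_zero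
  push_cast
  field_simp
  ring

/-- Substituting `α ↦ -α` shows, for even `m`, that the defining integral equals its conjugate, so
taking real parts loses nothing. -/
lemma ofReal_heatKernel (hm : Even m) (x : ℝ) :
    (heatKernel m t x : ℂ) = (1 / (2 * Real.pi) : ℂ) *
      𝓕 (heatSymbol m t) (x / (2 * Real.pi)) := by
  rw [heatKernel, integral_exp_eq_fourier_heatSymbol]
  apply Complex.conj_eq_iff_re.1
  rw [map_mul, ← integral_exp_eq_fourier_heatSymbol, ← integral_conj]
  congr 1
  · simp [← Complex.ofReal_ofNat, Complex.conj_ofReal]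
  · rw [← integral_neg_eq_self]
    refine integral_congr_ae (ae_of_all _ fun a => ?_)
    simp only [← Complex.exp_conj]
    congr 1
    simp [hm.neg_pow]

lemma integrable_heatKernel (hm : Even m) (hm0 : 0 < m) (ht : 0 < t) :
    Integrable (heatKernel m t) := by
  have h : heatKernel m t = fun x => ((1 / (2 * Real.pi) : ℂ) *
      𝓕 (heatSymbol m t) (x / (2 * Real.pi))).re := by
    funext x; rw [← ofReal_heatKernel hm, Complex.ofReal_re]
  rw [h]
  exact (((integrable_fourier_heatSymbol hm hm0 ht).comp_div (by positivity)).const_mul _).re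

/-- Fourier inversion for the symbol; the dilation by `2π` reconciles the two normalisations of the
transform. -/
lemma integral_heatKernel_mul_exp (hm : Even m) (hm0 : 0 < m) (ht : 0 < t) (l : ℝ) :
    ∫ y : ℝ, (heatKernel m t y : ℂ) * Complex.exp (Complex.I * l * y) =
      (Real.exp (-t * l ^ m) : ℝ) := by
  have h := congrFun (continuous_heatSymbol.fourierInv_fourier_eq (integrable_heatSymbol hm hm0 ht)
    (integrable_fourier_heatSymbol hm hm0 ht)) l
  rw [Real.fourierInv_eq_fourier_neg, Real.fourier_real_eq_integral_exp_smul] at h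
  rw [← heatSymbol, ← h]
  have hs := Measure.integral_comp_div
    (fun y : ℝ => Complex.exp (Complex.I * l * (2 * Real.pi * y)) * 𝓕 (heatSymbol m t) y)
    (2 * Real.pi)
  have hpi : (Real.pi : ℂ) ≠ 0 := by exact_mod_cast Real.pi_ne_zero
  have e1 : ∫ y : ℝ, (heatKernel m t y : ℂ) * Complex.exp (Complex.I * l * y) =
      (1 / (2 * Real.pi) : ℂ) * ∫ y : ℝ, Complex.exp (Complex.I * l *
        (2 * Real.pi * ((y / (2 * Real.pi) : ℝ) : ℂ))) * 𝓕 (heatSymbol m t) (y / (2 * Real.pi)) := by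
    rw [← integral_const_mul]
    refine integral_congr_ae (ae_of_all _ fun y => ?_)
    simp only [ofReal_heatKernel hm]
    have : (2 * Real.pi * ((y / (2 * Real.pi) : ℝ) : ℂ)) = y := by
      push_cast; field_simp
    rw [this]; ring
  rw [e1, hs, abs_of_pos (by positivity), Complex.real_smul, ← mul_assoc]
  have : (1 / (2 * Real.pi) : ℂ) * ((2 * Real.pi : ℝ) : ℂ) = 1 := by
    push_cast; field_simp
  rw [this, one_mul]
  refine integral_congr_ae (ae_of_all _ fun y => ?_)
  simp only [smul_eq_mul]
  congr 2
  push_cast; ring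

lemma measurable_heatKernel : Measurable (heatKernel m t) := by
  unfold heatKernel
  refine Complex.measurable_re.comp (Measurable.const_mul ?_ _)
  refine StronglyMeasurable.measurable (StronglyMeasurable.integral_prod_right
    (f := fun (x : ℝ) (α : ℝ) =>
      Complex.exp (-Complex.I * (α : ℂ) * (x : ℂ) - (α : ℂ) ^ m * (t : ℂ))) ?_)
  apply Continuous.stronglyMeasurable
  fun_prop

end HeatKernel
-- Spectral density of the covariance and its value at zero.
section SpectralDensity

variable {κ : ℝ}

/-- The scale mixture kernel: the density of a centred Gaussian law of variance `2s`, weighted by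
the (unnormalised) Gamma density of shape `κ/2`. -/
noncomputable def mixtureKernel (κ s l : ℝ) : ℝ :=
  s ^ (κ / 2 - 1) * Real.exp (-s) * ((√(4 * Real.pi * s))⁻¹ * Real.exp (-(1 / (4 * s)) * l ^ 2))

/-- The spectral density of the covariance function `(1 + x²)^(-κ/2)`. -/
noncomputable def mixtureDensity (κ l : ℝ) : ℝ :=
  (Real.Gamma (κ / 2))⁻¹ * ∫ s in Set.Ioi (0 : ℝ), mixtureKernel κ s l

lemma mixtureKernel_nonneg {s : ℝ} (hs : 0 < s) (l : ℝ) : 0 ≤ mixtureKernel κ s l := by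
  unfold mixtureKernel; positivity

lemma measurable_mixtureKernel : Measurable (fun p : ℝ × ℝ => mixtureKernel κ p.1 p.2) := by
  unfold mixtureKernel; fun_prop

lemma mixtureDensity_neg (l : ℝ) : mixtureDensity κ (-l) = mixtureDensity κ l := by
  simp [mixtureDensity, mixtureKernel]

lemma integral_exp_mul_gaussian {s : ℝ} (hs : 0 < s) (x : ℝ) :
    ∫ l : ℝ, Complex.exp (Complex.I * x * l) *
      (((√(4 * Real.pi * s))⁻¹ * Real.exp (-(1 / (4 * s)) * l ^ 2) : ℝ) : ℂ) =
      ((Real.exp (-(s * x ^ 2)) : ℝ) : ℂ) := by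
  have h := fourierIntegral_gaussian (b := ((1 / (4 * s) : ℝ) : ℂ))
    (by rw [Complex.ofReal_re]; positivity) x
  have e : ∀ l : ℝ, Complex.exp (Complex.I * x * l) *
      (((√(4 * Real.pi * s))⁻¹ * Real.exp (-(1 / (4 * s)) * l ^ 2) : ℝ) : ℂ) =
      (((√(4 * Real.pi * s))⁻¹ : ℝ) : ℂ) * (Complex.exp (Complex.I * x * l) *
        Complex.exp (-((1 / (4 * s) : ℝ) : ℂ) * l ^ 2)) := by
    intro l; push_cast; ring
  simp_rw [e]
  rw [integral_const_mul, h]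
  have h1 : (Real.pi / ((1 / (4 * s) : ℝ) : ℂ)) ^ (1 / 2 : ℂ) = ((√(4 * Real.pi * s) : ℝ) : ℂ) := by
    rw [Real.sqrt_eq_rpow, Complex.ofReal_cpow (by positivity)]
    push_cast
    congr 1
    field_simp
  rw [h1, ← mul_assoc, ← Complex.ofReal_mul, inv_mul_cancel₀ (by positivity), Complex.ofReal_one,
    one_mul, Complex.ofReal_exp]
  congr 1
  have : (s : ℂ) ≠ 0 := by exact_mod_cast hs.ne'
  push_cast
  field_simp

lemma integral_gaussian_normalised {s : ℝ} (hs : 0 < s) :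
    ∫ l : ℝ, (√(4 * Real.pi * s))⁻¹ * Real.exp (-(1 / (4 * s)) * l ^ 2) = 1 := by
  rw [integral_const_mul, integral_gaussian]
  have : Real.pi / (1 / (4 * s)) = 4 * Real.pi * s := by field_simp
  rw [this, inv_mul_cancel₀ (by positivity)]

lemma integrable_gamma_weight (hκ : 0 < κ) :
    IntegrableOn (fun s : ℝ => s ^ (κ / 2 - 1) * Real.exp (-s)) (Set.Ioi 0) := by
  simpa only [mul_comm] using Real.GammaIntegral_convergent (half_pos hκ)

lemma integrable_mixtureKernel (hκ : 0 < κ) :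
    Integrable (fun p : ℝ × ℝ => mixtureKernel κ p.1 p.2)
      ((volume.restrict (Set.Ioi 0)).prod volume) := by
  rw [integrable_prod_iff measurable_mixtureKernel.aestronglyMeasurable]
  constructor
  · refine (ae_restrict_iff' measurableSet_Ioi).2 (ae_of_all _ fun s (hs : 0 < s) => ?_)
    have hb : 0 < 1 / (4 * s) := by positivity
    simp only [mixtureKernel]
    exact ((integrable_exp_neg_mul_sq hb).const_mul _).const_mul _
  · refine (integrable_gamma_weight hκ).congr ?_
    refine (ae_restrict_iff' measurableSet_Ioi).2 (ae_of_all _ fun s (hs : 0 < s) => ?_)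
    simp only [Real.norm_of_nonneg (mixtureKernel_nonneg hs _)]
    simp only [mixtureKernel]
    rw [integral_const_mul, integral_gaussian_normalised hs, mul_one]

lemma integrable_mixtureDensity (hκ : 0 < κ) : Integrable (mixtureDensity κ) :=
  (integrable_mixtureKernel hκ).integral_prod_right.const_mul _

/-- After Fubini the inner integral is the Gaussian characteristic function `exp(-s x²)`, and what
remains is a Gamma integral with rate `1 + x²`. -/
lemma integral_exp_mul_mixtureDensity (hκ : 0 < κ) (x : ℝ) :
    ∫ l : ℝ, Complex.exp (Complex.I * x * l) * (mixtureDensity κ l : ℂ) =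
      (((1 / (1 + x ^ 2) ^ (κ / 2) : ℝ)) : ℂ) := by
  have hG : Real.Gamma (κ / 2) ≠ 0 := (Real.Gamma_pos_of_pos (half_pos hκ)).ne'
  have hi : Integrable (Function.uncurry fun (s l : ℝ) => Complex.exp (Complex.I * x * l) *
      (mixtureKernel κ s l : ℂ)) ((volume.restrict (Set.Ioi 0)).prod volume) := by
    refine (integrable_mixtureKernel hκ).norm.mono' ?_ (ae_of_all _ fun p => ?_)
    · refine Measurable.aestronglyMeasurable (Measurable.mul (by fun_prop) ?_)
      exact Complex.measurable_ofReal.comp measurable_mixtureKernel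
    · have : Complex.I * x * p.2 = ((x * p.2 : ℝ) : ℂ) * Complex.I := by push_cast; ring
      simp only [Function.uncurry, norm_mul, this, Complex.norm_exp_ofReal_mul_I, one_mul,
        Complex.norm_real, le_refl]
  have h1 : ∀ l : ℝ, Complex.exp (Complex.I * x * l) * (mixtureDensity κ l : ℂ) =
      (((Real.Gamma (κ / 2))⁻¹ : ℝ) : ℂ) * ∫ s in Set.Ioi (0 : ℝ),
        Complex.exp (Complex.I * x * l) * (mixtureKernel κ s l : ℂ) := by
    intro l
    rw [integral_const_mul, integral_complex_ofReal, mixtureDensity]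
    push_cast; ring
  simp_rw [h1]
  rw [integral_const_mul, ← integral_integral_swap hi]
  have h2 : ∫ s in Set.Ioi (0 : ℝ), ∫ l : ℝ, Complex.exp (Complex.I * x * l) *
      (mixtureKernel κ s l : ℂ) = ((∫ s in Set.Ioi (0 : ℝ),
        s ^ (κ / 2 - 1) * Real.exp (-((1 + x ^ 2) * s)) : ℝ) : ℂ) := by
    rw [← integral_complex_ofReal]
    refine setIntegral_congr_fun measurableSet_Ioi fun s (hs : 0 < s) => ?_
    have e : ∀ l : ℝ, Complex.exp (Complex.I * x * l) * (mixtureKernel κ s l : ℂ) =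
      ((s ^ (κ / 2 - 1) * Real.exp (-s) : ℝ) : ℂ) * (Complex.exp (Complex.I * x * l) *
        (((√(4 * Real.pi * s))⁻¹ * Real.exp (-(1 / (4 * s)) * l ^ 2) : ℝ) : ℂ)) := by
      intro l; rw [mixtureKernel]; push_cast; ring
    simp only [e]
    rw [integral_const_mul, integral_exp_mul_gaussian hs, ← Complex.ofReal_mul, mul_assoc,
      ← Real.exp_add]
    congr 3
    ring_nf
  rw [h2, Real.integral_rpow_mul_exp_neg_mul_Ioi (half_pos hκ) (by positivity),
    ← Complex.ofReal_mul]
  congr 1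
  rw [Real.div_rpow zero_le_one (by positivity), Real.one_rpow]
  field_simp

lemma sqrt_mul_exp_neg_le_one {y : ℝ} (hy : 0 ≤ y) : √y * Real.exp (-y) ≤ 1 := by
  rw [Real.exp_neg, ← div_eq_mul_inv, div_le_one (Real.exp_pos _)]
  have h1 := Real.add_one_le_exp y
  have h2 : √y ≤ y + 1 := by
    rw [Real.sqrt_le_left (by positivity)]; nlinarith
  linarith

/-- Away from `l = 0` the Gaussian factor absorbs the singularity `s^(-1/2)`, by `√y exp(-y) ≤ 1` at
`y = δ²/(4s)`. This is the domination behind continuity off the origin; at the origin the integral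
over `s` diverges for `κ < 1`. -/
lemma mixtureKernel_le {s l δ : ℝ} (hs : 0 < s) (hδ : 0 < δ) (hl : δ ≤ |l|) :
    mixtureKernel κ s l ≤ (δ * √Real.pi)⁻¹ * (s ^ (κ / 2 - 1) * Real.exp (-s)) := by
  have hl2 : δ ^ 2 ≤ l ^ 2 := by rw [← sq_abs l]; gcongr
  have h := sqrt_mul_exp_neg_le_one (y := δ ^ 2 / (4 * s)) (by positivity)
  have e1 : √(δ ^ 2 / (4 * s)) = δ * √Real.pi * (√(4 * Real.pi * s))⁻¹ := by
    rw [Real.sqrt_div (by positivity), Real.sqrt_sq hδ.le,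
      show 4 * Real.pi * s = Real.pi * (4 * s) by ring, Real.sqrt_mul Real.pi_pos.le]
    have : √Real.pi ≠ 0 := by positivity
    field_simp
  have h3 : (√(4 * Real.pi * s))⁻¹ * Real.exp (-(1 / (4 * s)) * l ^ 2) ≤ (δ * √Real.pi)⁻¹ := by
    rw [le_inv_comm₀ (by positivity) (by positivity), ← one_div, le_div_iff₀ (by positivity)]
    refine le_trans ?_ h
    rw [e1, ← mul_assoc]
    gcongr
    rw [neg_mul, neg_le_neg_iff, one_div_mul_eq_div]
    gcongr
  rw [mixtureKernel, mul_comm (δ * √Real.pi)⁻¹]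
  gcongr

lemma continuousAt_mixtureDensity (hκ : 0 < κ) {w : ℝ} (hw : w ≠ 0) :
    ContinuousAt (mixtureDensity κ) w := by
  refine ContinuousAt.mul continuousAt_const ?_
  refine continuousAt_of_dominated (bound := fun s => (|w| / 2 * √Real.pi)⁻¹ *
    (s ^ (κ / 2 - 1) * Real.exp (-s))) ?_ ?_ ((integrable_gamma_weight hκ).const_mul _) ?_
  · refine Eventually.of_forall fun l => Measurable.aestronglyMeasurable ?_
    unfold mixtureKernel; fun_prop
  · have : ∀ᶠ l : ℝ in 𝓝 w, |w| / 2 < |l| :=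
      continuous_abs.continuousAt.eventually_const_lt (half_lt_self (abs_pos.2 hw))
    filter_upwards [this] with l hl
    refine (ae_restrict_iff' measurableSet_Ioi).2 (ae_of_all _ fun s (hs : 0 < s) => ?_)
    rw [Real.norm_of_nonneg (mixtureKernel_nonneg hs _)]
    exact mixtureKernel_le hs (half_pos (abs_pos.2 hw)) hl.le
  · refine ae_of_all _ fun s => Continuous.continuousAt ?_
    unfold mixtureKernel; fun_prop

lemma mixtureDensity_eq_besselK (hκ : 0 < κ) {w : ℝ} (hw : w ≠ 0) :
    mixtureDensity κ w = c₁ κ * besselK ((κ - 1) / 2) |w| * |w| ^ ((κ - 1) / 2) := by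
  have ha : 0 < |w| := abs_pos.2 hw
  -- The substitution `s = |w| v / 2` symmetrises the exponent: `s + w²/(4s) = (|w|/2)(v + 1/v)`.
  have hsub := integral_comp_mul_left_Ioi (fun s => mixtureKernel κ s w) 0 (half_pos ha)
  rw [mul_zero, smul_eq_mul] at hsub
  have hI : ∫ s in Set.Ioi (0 : ℝ), mixtureKernel κ s w =
      |w| / 2 * ∫ v in Set.Ioi (0 : ℝ), mixtureKernel κ (|w| / 2 * v) w := by
    rw [hsub]; field_simp
  have hk : ∫ v in Set.Ioi (0 : ℝ), mixtureKernel κ (|w| / 2 * v) w =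
      ((|w| / 2) ^ ((κ - 1) / 2 - 1) * (2 * √Real.pi)⁻¹) * ∫ v in Set.Ioi (0 : ℝ),
        v ^ ((κ - 1) / 2 - 1) * Real.exp (-(1 / 2) * (v + 1 / v) * |w|) := by
    rw [← integral_const_mul]
    refine setIntegral_congr_fun measurableSet_Ioi fun v (hv : 0 < v) => ?_
    have hs : 0 < |w| / 2 * v := by positivity
    have e1 : √(4 * Real.pi * (|w| / 2 * v)) = 2 * √Real.pi * (|w| / 2 * v) ^ (1 / 2 : ℝ) := by
      rw [← Real.sqrt_eq_rpow, Real.sqrt_mul (by positivity), Real.sqrt_mul (by positivity),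
        show (4 : ℝ) = 2 ^ 2 by norm_num, Real.sqrt_sq (by norm_num)]
    have e2 : (|w| / 2 * v) ^ (κ / 2 - 1) * ((|w| / 2 * v) ^ (1 / 2 : ℝ))⁻¹ =
        (|w| / 2) ^ ((κ - 1) / 2 - 1) * v ^ ((κ - 1) / 2 - 1) := by
      rw [← Real.rpow_neg hs.le, ← Real.rpow_add hs, ← Real.mul_rpow (by positivity) hv.le]
      congr 1; ring
    have e3 : Real.exp (-(|w| / 2 * v)) * Real.exp (-(1 / (4 * (|w| / 2 * v))) * w ^ 2) =
        Real.exp (-(1 / 2) * (v + 1 / v) * |w|) := by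
      rw [← Real.exp_add, ← sq_abs w]
      congr 1
      field_simp
      ring
    simp only [mixtureKernel]
    rw [e1, ← e3, mul_inv]
    linear_combination (Real.exp (-(|w| / 2 * v)) *
      Real.exp (-(1 / (4 * (|w| / 2 * v))) * w ^ 2) * (2 * √Real.pi)⁻¹) * e2
  have e4 : |w| / 2 * (|w| / 2) ^ ((κ - 1) / 2 - 1) =
      |w| ^ ((κ - 1) / 2) * (2 : ℝ) ^ ((1 - κ) / 2) := by
    rw [Real.rpow_sub_one (by positivity), mul_div_cancel₀ _ (by positivity),
      Real.div_rpow ha.le (by norm_num), show (1 - κ) / 2 = -((κ - 1) / 2) by ring,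
      Real.rpow_neg (by norm_num)]
    rfl
  have hG : Real.Gamma (κ / 2) ≠ 0 := (Real.Gamma_pos_of_pos (half_pos hκ)).ne'
  have hp : √Real.pi ≠ 0 := by positivity
  rw [mixtureDensity, hI, hk, c₁, besselK]
  set J := ∫ v in Set.Ioi (0 : ℝ), v ^ ((κ - 1) / 2 - 1) *
    Real.exp (-(1 / 2) * (v + 1 / v) * |w|)
  calc _ = (|w| / 2 * (|w| / 2) ^ ((κ - 1) / 2 - 1)) * (Real.Gamma (κ / 2))⁻¹ *
        (2 * √Real.pi)⁻¹ * J := by ring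
    _ = _ := by rw [e4]; field_simp

variable {n : ℕ}

/-- The spectral density of `cyclicCov κ w A`. -/
noncomputable def spectralDensity (κ w A : Fin n → ℝ) (l : ℝ) : ℝ :=
  ∑ j, A j * ((mixtureDensity (κ j) (l - w j) + mixtureDensity (κ j) (l + w j)) / 2)

variable {κ w A : Fin n → ℝ}

lemma integrable_spectralDensity (hκ : ∀ j, 0 < κ j) : Integrable (spectralDensity κ w A) :=
  integrable_finsetSum _ fun j _ => ((((integrable_mixtureDensity (hκ j)).comp_sub_right _).add
    ((integrable_mixtureDensity (hκ j)).comp_add_right _)).div_const 2).const_mul _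

lemma continuousAt_spectralDensity_zero (hκ : ∀ j, 0 < κ j) (hw : ∀ j, w j ≠ 0) :
    ContinuousAt (spectralDensity κ w A) 0 := by
  refine tendsto_finsetSum _ fun j _ => ?_
  have h1 : ContinuousAt (fun l => mixtureDensity (κ j) (l - w j)) 0 :=
    ContinuousAt.comp (f := fun l => l - w j) (g := mixtureDensity (κ j))
      (continuousAt_mixtureDensity (hκ j) (by simpa using hw j)) (by fun_prop)
  have h2 : ContinuousAt (fun l => mixtureDensity (κ j) (l + w j)) 0 :=
    ContinuousAt.comp (f := fun l => l + w j) (g := mixtureDensity (κ j))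
      (continuousAt_mixtureDensity (hκ j) (by simpa using hw j)) (by fun_prop)
  exact ((h1.add h2).div_const 2).const_mul (A j)

lemma spectralDensity_zero (hκ : ∀ j, 0 < κ j) (hw : ∀ j, w j ≠ 0) :
    spectralDensity κ w A 0 = spectralAtZero κ w A := by
  refine Finset.sum_congr rfl fun j _ => ?_
  rw [zero_sub, zero_add, mixtureDensity_neg, mixtureDensity_eq_besselK (hκ j) (hw j)]
  ring

lemma norm_exp_I_mul_mul (x l : ℝ) : ‖Complex.exp (Complex.I * x * l)‖ = 1 := by
  have : Complex.I * x * l = ((x * l : ℝ) : ℂ) * Complex.I := by push_cast; ring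
  rw [this, Complex.norm_exp_ofReal_mul_I]

lemma integrable_exp_mul {f : ℝ → ℂ} (hf : Integrable f) (x : ℝ) :
    Integrable fun l : ℝ => Complex.exp (Complex.I * x * l) * f l :=
  hf.norm.mono' ((Continuous.aestronglyMeasurable (by fun_prop)).mul hf.1)
    (ae_of_all _ fun l => by rw [norm_mul, norm_exp_I_mul_mul, one_mul])

lemma integral_exp_mul_translate (f : ℝ → ℂ) (x w : ℝ) :
    ∫ l : ℝ, Complex.exp (Complex.I * x * l) * f (l + w) =
      Complex.exp (-(Complex.I * (x * w))) * ∫ l : ℝ, Complex.exp (Complex.I * x * l) * f l := by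
  rw [← integral_add_right_eq_self (fun l : ℝ => Complex.exp (Complex.I * x * l) * f l) w,
    ← integral_const_mul]
  refine integral_congr_ae (ae_of_all _ fun l => ?_)
  simp only [← mul_assoc, ← Complex.exp_add]
  congr 2
  push_cast; ring

lemma integral_exp_mul_spectralDensity (hκ : ∀ j, 0 < κ j) (x : ℝ) :
    ∫ l : ℝ, Complex.exp (Complex.I * x * l) * (spectralDensity κ w A l : ℂ) =
      (cyclicCov κ w A x : ℂ) := by
  have hi (j : Fin n) (v : ℝ) : Integrable fun l : ℝ => Complex.exp (Complex.I * x * l) *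
      (mixtureDensity (κ j) (l + v) : ℂ) :=
    integrable_exp_mul ((integrable_mixtureDensity (hκ j)).comp_add_right v).ofReal x
  have e (l : ℝ) : Complex.exp (Complex.I * x * l) * (spectralDensity κ w A l : ℂ) =
      ∑ j, (A j / 2 : ℂ) * (Complex.exp (Complex.I * x * l) *
        (mixtureDensity (κ j) (l + -w j) : ℂ) +
        Complex.exp (Complex.I * x * l) * (mixtureDensity (κ j) (l + w j) : ℂ)) := by
    rw [spectralDensity, Complex.ofReal_sum, Finset.mul_sum]
    refine Finset.sum_congr rfl fun j _ => ?_
    rw [← sub_eq_add_neg]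
    push_cast; ring
  simp_rw [e]
  rw [integral_finsetSum _ fun j _ => by exact ((hi j _).add (hi j _)).const_mul _, cyclicCov,
    Complex.ofReal_sum]
  refine Finset.sum_congr rfl fun j _ => ?_
  rw [integral_const_mul, integral_add (hi j _) (hi j _),
    integral_exp_mul_translate (fun l => (mixtureDensity (κ j) l : ℂ)),
    integral_exp_mul_translate (fun l => (mixtureDensity (κ j) l : ℂ)),
    integral_exp_mul_mixtureDensity (hκ j)]
  have hc : Complex.cos ((w j * x : ℝ) : ℂ) = (Complex.exp (-(Complex.I * (x * (-w j : ℝ)))) +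
      Complex.exp (-(Complex.I * (x * w j)))) / 2 := by
    rw [Complex.cos]
    congr 3 <;> (push_cast; ring_nf)
  push_cast at hc ⊢
  rw [div_eq_mul_one_div (Complex.cos _), hc]
  ring

end SpectralDensity
-- Closed Gaussian subspaces of `L²`.
section GaussianSubspace

variable {Ω : Type*} [MeasurableSpace Ω] {P : Measure Ω}

lemma coeFn_finsetSum {ι E : Type*} [NormedAddCommGroup E] (s : Finset ι) (X : ι → Lp E 2 P) :
    (⇑(∑ i ∈ s, X i) : Ω → E) =ᵐ[P] fun ω => ∑ i ∈ s, X i ω := by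
  classical
  induction s using Finset.induction_on with
  | empty =>
    simp only [Finset.sum_empty]
    exact Lp.coeFn_zero E 2 P
  | insert i s hi ih =>
    simp only [Finset.sum_insert hi]
    filter_upwards [Lp.coeFn_add (X i) (∑ i ∈ s, X i), ih] with ω h1 h2
    rw [h1, Pi.add_apply, h2]

lemma coeFn_finsetSum_smul {ι : Type*} (s : Finset ι) (c : ι → ℝ) (X : ι → Lp ℝ 2 P) :
    (⇑(∑ i ∈ s, c i • X i) : Ω → ℝ) =ᵐ[P] fun ω => ∑ i ∈ s, c i * X i ω := by
  have h : ∀ᵐ ω ∂P, ∀ i : s, (⇑(c i • X i) : Ω → ℝ) ω = c i * X i ω := by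
    rw [ae_all_iff]
    intro i
    filter_upwards [Lp.coeFn_smul (c i) (X i)] with ω h
    simp [h]
  filter_upwards [coeFn_finsetSum s fun i => c i • X i, h] with ω h1 h2
  rw [h1]
  exact Finset.sum_congr rfl fun i hi => h2 ⟨i, hi⟩

/-- A square integrable random variable whose law is a centred Gaussian law. -/
def IsCenteredGaussian (X : Lp ℝ 2 P) : Prop :=
  ∀ t : ℝ, charFun (P.map X) t = Complex.exp (-((t ^ 2 * ‖X‖ ^ 2 / 2 : ℝ) : ℂ))

lemma norm_sq_eq_integral (X : Lp ℝ 2 P) : ‖X‖ ^ 2 = ∫ ω, X ω ^ 2 ∂P := by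
  rw [← real_inner_self_eq_norm_sq, L2.inner_def]
  simp [pow_two]

/-- The closed linear span in `L²` of a family of random variables. -/
noncomputable def closedSpan {T : Type*} (Y : T → Lp ℝ 2 P) : Submodule ℝ (Lp ℝ 2 P) :=
  (Submodule.span ℝ (Set.range Y)).topologicalClosure

lemma mem_closedSpan {T : Type*} (Y : T → Lp ℝ 2 P) (t : T) : Y t ∈ closedSpan Y :=
  Submodule.le_topologicalClosure _ (Submodule.subset_span ⟨t, rfl⟩)

variable [IsProbabilityMeasure P]

/-- Convergence in `L²` implies convergence in law, while the prescribed characteristic function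
depends continuously on the norm. Both pass to the limit, degenerate laws included. -/
lemma isClosed_isCenteredGaussian : IsClosed {X : Lp ℝ 2 P | IsCenteredGaussian X} := by
  refine IsSeqClosed.isClosed fun X Y hX hXY t => ?_
  have hm : ∀ n, AEMeasurable (X n) P := fun n => (Lp.aestronglyMeasurable (X n)).aemeasurable
  have hd := (tendstoInMeasure_of_tendsto_Lp hXY).tendstoInDistribution hm
  have h1 := ProbabilityMeasure.tendsto_iff_tendsto_charFun.1 hd.tendsto t
  have h2 : Tendsto (fun n => Complex.exp (-((t ^ 2 * ‖X n‖ ^ 2 / 2 : ℝ) : ℂ))) atTop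
      (𝓝 (Complex.exp (-((t ^ 2 * ‖Y‖ ^ 2 / 2 : ℝ) : ℂ)))) := by
    have hc : Continuous fun Z : Lp ℝ 2 P => Complex.exp (-((t ^ 2 * ‖Z‖ ^ 2 / 2 : ℝ) : ℂ)) := by
      fun_prop
    exact (hc.tendsto Y).comp hXY
  refine tendsto_nhds_unique h1 (h2.congr fun n => (hX n t).symm)

lemma isCenteredGaussian_of_hasGaussianLaw {X : Lp ℝ 2 P} (h : HasGaussianLaw X P)
    (h0 : ∫ ω, X ω ∂P = 0) : IsCenteredGaussian X := by
  intro t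
  rw [h.charFun_map_eq]
  have hv : Var[fun ω => inner ℝ t (X ω); P] = t ^ 2 * ‖X‖ ^ 2 := by
    have e : (fun ω => inner ℝ t (X ω)) = fun ω => t * X ω := by
      funext ω; simp [mul_comm]
    rw [e, variance_const_mul, variance_eq_sub h.memLp_two, h0, norm_sq_eq_integral]
    simp
  have hm : P[fun ω => inner ℝ t (X ω)] = 0 := by
    have e : (fun ω => inner ℝ t (X ω)) = fun ω => t * X ω := by
      funext ω; simp [mul_comm]
    rw [e, integral_const_mul, h0, mul_zero]
  rw [hv, hm]
  congr 1
  push_cast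
  ring

lemma IsCenteredGaussian.map_eq {X : Lp ℝ 2 P} (h : IsCenteredGaussian X) :
    P.map X = gaussianReal 0 (‖X‖₊ ^ 2) := by
  have : IsProbabilityMeasure (P.map X) :=
    Measure.isProbabilityMeasure_map (Lp.aestronglyMeasurable X).aemeasurable
  refine Measure.ext_of_charFun (funext fun t => ?_)
  rw [h t, charFun_gaussianReal]
  congr 1
  push_cast
  ring

lemma IsCenteredGaussian.hasGaussianLaw {X : Lp ℝ 2 P} (h : IsCenteredGaussian X) :
    HasGaussianLaw X P := ⟨by rw [h.map_eq]; infer_instance⟩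

lemma IsCenteredGaussian.integral_eq_zero {X : Lp ℝ 2 P} (h : IsCenteredGaussian X) :
    ∫ ω, X ω ∂P = 0 := by
  have h1 := integral_map (μ := P) (Lp.aestronglyMeasurable X).aemeasurable
    (f := fun x : ℝ => x) (by fun_prop)
  rw [← h1, h.map_eq, integral_id_gaussianReal]

lemma isCenteredGaussian_of_mem_closedSpan {T : Type*} {Y : T → Lp ℝ 2 P}
    (hY : IsGaussianProcess (fun t => (Y t : Ω → ℝ)) P) (h0 : ∀ t, ∫ ω, Y t ω ∂P = 0)
    {X : Lp ℝ 2 P} (hX : X ∈ closedSpan Y) : IsCenteredGaussian X := by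
  have hs : (Submodule.span ℝ (Set.range Y) : Set (Lp ℝ 2 P)) ⊆
      {X : Lp ℝ 2 P | IsCenteredGaussian X} := by
    intro X hX
    obtain ⟨c, rfl⟩ := Finsupp.mem_span_range_iff_exists_finsupp.1 hX
    have he := coeFn_finsetSum_smul c.support c Y
    have hg : HasGaussianLaw (fun ω => ∑ i ∈ c.support, c i * Y i ω) P := by
      simpa using (hY.smul c).hasGaussianLaw_fun_sum (I := c.support)
    refine isCenteredGaussian_of_hasGaussianLaw (hg.congr he.symm) ?_
    rw [Finsupp.sum, integral_congr_ae he,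
      integral_finsetSum _ fun i _ => (hY.hasGaussianLaw_eval i).integrable.const_mul _]
    simp [integral_const_mul, h0]
  exact closure_minimal hs isClosed_isCenteredGaussian hX

/-- Cramér–Wold: a linear functional of the vector is again an element of `H`, so one-dimensional
Gaussianity on a subspace is already joint Gaussianity. -/
lemma hasGaussianLaw_pi_of_mem {H : Submodule ℝ (Lp ℝ 2 P)} (hH : ∀ X ∈ H, IsCenteredGaussian X)
    {ι : Type*} [Fintype ι] {Z : ι → Ω → ℝ} {V : ι → Lp ℝ 2 P} (hV : ∀ i, V i ∈ H)
    (hZ : ∀ i, Z i =ᵐ[P] V i) : HasGaussianLaw (fun ω i => Z i ω) P := by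
  classical
  have hm : AEMeasurable (fun ω i => Z i ω) P :=
    aemeasurable_pi_lambda _ fun i =>
      (Lp.aestronglyMeasurable (V i)).aemeasurable.congr (hZ i).symm
  refine ⟨isGaussian_of_isGaussian_map fun L => ?_⟩
  rw [AEMeasurable.map_map_of_aemeasurable (by fun_prop) hm]
  have hmem : ∑ i, L (Pi.single i 1) • V i ∈ H :=
    H.sum_mem fun i _ => H.smul_mem _ (hV i)
  refine ((hH _ hmem).hasGaussianLaw.congr ?_).isGaussian_map
  filter_upwards [coeFn_finsetSum_smul Finset.univ (fun i => L (Pi.single i 1)) V,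
    ae_all_iff.2 hZ] with ω h1 h2
  rw [h1]
  simp only [Function.comp, ← h2]
  rw [← ContinuousLinearMap.sum_comp_single ℝ (fun _ : ι => ℝ) L (fun i => Z i ω)]
  refine Finset.sum_congr rfl fun i _ => ?_
  have : Pi.single i (Z i ω) = Z i ω • (Pi.single i 1 : ι → ℝ) := by
    rw [← Pi.single_smul]; simp
  simp [this, mul_comm]

lemma isGaussianProcess_of_mem {H : Submodule ℝ (Lp ℝ 2 P)} (hH : ∀ X ∈ H, IsCenteredGaussian X)
    {S : Type*} {Z : S → Ω → ℝ} {V : S → Lp ℝ 2 P} (hV : ∀ s, V s ∈ H)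
    (hZ : ∀ s, Z s =ᵐ[P] V s) : IsGaussianProcess Z P :=
  ⟨fun _ => hasGaussianLaw_pi_of_mem hH (fun i => hV i) fun i => hZ i⟩

end GaussianSubspace

/-! ### Convergence of Gaussian vectors from convergence of covariances. -/

section ConvergenceInLaw

variable {Ω : Type*} [MeasurableSpace Ω] {P : Measure Ω} [IsProbabilityMeasure P]

lemma charFun_map_toLp_of_hasGaussianLaw {N : ℕ} {U : Fin N → Ω → ℝ}
    (hU : HasGaussianLaw (fun ω i => U i ω) P) (h0 : ∀ i, ∫ ω, U i ω ∂P = 0)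
    (t : EuclideanSpace ℝ (Fin N)) :
    charFun (P.map fun ω => WithLp.toLp 2 fun i => U i ω) t =
      Complex.exp (-((∑ i, ∑ j, t i * t j * cov[U i, U j; P] : ℝ) : ℂ) / 2) := by
  have hG := hU.toLp_pi 2
  have hL : ∀ i, MemLp (U i) 2 P := fun i => (hU.eval i).memLp_two
  rw [hG.charFun_map_eq]
  have e : (fun ω => inner ℝ t (WithLp.toLp 2 fun i => U i ω)) = fun ω => ∑ i, t i * U i ω := by
    funext ω
    simp [PiLp.inner_apply, mul_comm]
  have hm : P[fun ω => inner ℝ t (WithLp.toLp 2 fun i => U i ω)] = 0 := by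
    rw [e, integral_finsetSum _ fun i _ => ((hL i).integrable one_le_two).const_mul _]
    simp [integral_const_mul, h0]
  have hv : Var[fun ω => inner ℝ t (WithLp.toLp 2 fun i => U i ω); P] =
      ∑ i, ∑ j, t i * t j * cov[U i, U j; P] := by
    rw [e, variance_fun_sum fun i => (hL i).const_mul _]
    refine Finset.sum_congr rfl fun i _ => Finset.sum_congr rfl fun j _ => ?_
    rw [covariance_const_mul_left, covariance_const_mul_right]
    ring
  rw [hm, hv]
  congr 1
  push_cast
  ring

/-- Lévy continuity: a centred Gaussian characteristic function is a continuous function of the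
covariances. The work is done in `EuclideanSpace`, whose inner product defines `charFun`, and is
carried back by a continuous map. -/
lemma tendstoInDistribution_of_tendsto_cov {Ω' : Type*} [MeasurableSpace Ω'] {P' : Measure Ω'}
    [IsProbabilityMeasure P'] {N : ℕ} {l : Filter ℝ} [l.IsCountablyGenerated]
    {U : ℝ → Fin N → Ω → ℝ} {Z : Fin N → Ω' → ℝ}
    (hmeas : ∀ ε, AEMeasurable (fun ω i => U ε i ω) P)
    (hU : ∀ᶠ ε in l, HasGaussianLaw (fun ω i => U ε i ω) P ∧ ∀ i, ∫ ω, U ε i ω ∂P = 0)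
    (hZ : HasGaussianLaw (fun ω i => Z i ω) P') (hZ0 : ∀ i, ∫ ω, Z i ω ∂P' = 0)
    (hcov : ∀ i j, Tendsto (fun ε => cov[U ε i, U ε j; P]) l (𝓝 cov[Z i, Z j; P'])) :
    TendstoInDistribution (fun ε ω i => U ε i ω) l (fun ω i => Z i ω) (fun _ => P) P' := by
  have hE : TendstoInDistribution (fun ε ω => (WithLp.toLp 2 fun i => U ε i ω :
      EuclideanSpace ℝ (Fin N))) l (fun ω => WithLp.toLp 2 fun i => Z i ω) (fun _ => P) P' := by
    have hc : Measurable (WithLp.toLp 2 : (Fin N → ℝ) → EuclideanSpace ℝ (Fin N)) :=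
      (PiLp.continuous_toLp 2 _).measurable
    refine ⟨fun ε => hc.comp_aemeasurable (hmeas ε), hc.comp_aemeasurable hZ.aemeasurable, ?_⟩
    refine tendsto_of_seq_tendsto fun u hu => ?_
    refine ProbabilityMeasure.tendsto_iff_tendsto_charFun.2 fun t => ?_
    simp only [Function.comp, ProbabilityMeasure.coe_mk]
    rw [charFun_map_toLp_of_hasGaussianLaw hZ hZ0]
    have hcont : Continuous fun x : ℝ => Complex.exp (-(x : ℂ) / 2) := by fun_prop
    have hsum : Tendsto (fun ε => ∑ i, ∑ j, t i * t j * cov[U ε i, U ε j; P]) l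
        (𝓝 (∑ i, ∑ j, t i * t j * cov[Z i, Z j; P'])) :=
      tendsto_finsetSum _ fun i _ => tendsto_finsetSum _ fun j _ => (hcov i j).const_mul _
    refine (((hcont.tendsto _).comp hsum).comp hu).congr' ?_
    filter_upwards [hu.eventually hU] with n hn
    exact (charFun_map_toLp_of_hasGaussianLaw hn.1 hn.2 t).symm
  exact hE.continuous_comp (PiLp.continuous_ofLp 2 _)

end ConvergenceInLaw
-- Pathwise convolutions as Bochner integrals in `L²`.
section PathIntegral

variable {Ω : Type*} [MeasurableSpace Ω] {P : Measure Ω}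

/-- A jointly measurable, centred, stationary Gaussian process with continuous covariance `r`. -/
structure IsStationaryGaussian (ζ : ℝ → Ω → ℝ) (r : ℝ → ℝ) (P : Measure Ω) : Prop where
  measurable : Measurable (fun p : ℝ × Ω => ζ p.1 p.2)
  gaussian : IsGaussianProcess ζ P
  mean_zero : ∀ y, ∫ ω, ζ y ω ∂P = 0
  covariance : ∀ y y', ∫ ω, ζ y ω * ζ y' ω ∂P = r (y' - y)
  continuous : Continuous r

namespace IsStationaryGaussian

variable {ζ : ℝ → Ω → ℝ} {r : ℝ → ℝ}

lemma memLp (h : IsStationaryGaussian ζ r P) (y : ℝ) : MemLp (ζ y) 2 P :=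
  (h.gaussian.hasGaussianLaw_eval y).memLp_two

/-- The process as a curve in `L²`. -/
noncomputable def curve (h : IsStationaryGaussian ζ r P) (y : ℝ) : Lp ℝ 2 P := (h.memLp y).toLp

lemma inner_curve (h : IsStationaryGaussian ζ r P) (y y' : ℝ) :
    inner ℝ (h.curve y) (h.curve y') = r (y' - y) := by
  rw [L2.inner_def, ← h.covariance]
  refine integral_congr_ae ?_
  filter_upwards [(h.memLp y).coeFn_toLp, (h.memLp y').coeFn_toLp] with ω h1 h2
  simp only [curve, h1, h2]
  simp [mul_comm]

lemma norm_sq_curve (h : IsStationaryGaussian ζ r P) (y : ℝ) : ‖h.curve y‖ ^ 2 = r 0 := by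
  rw [← real_inner_self_eq_norm_sq, inner_curve, sub_self]

lemma continuous_curve (h : IsStationaryGaussian ζ r P) : Continuous h.curve := by
  rw [continuous_iff_continuousAt]
  intro y
  rw [ContinuousAt, tendsto_iff_norm_sub_tendsto_zero]
  -- Mean-square increments depend only on `r`, so continuity of the curve is continuity of `r` at
  -- `0`.
  have e : ∀ y', ‖h.curve y' - h.curve y‖ = √(r 0 - 2 * r (y - y') + r 0) := by
    intro y'
    rw [← Real.sqrt_sq (norm_nonneg (h.curve y' - h.curve y)), norm_sub_sq_real, h.norm_sq_curve,
      h.norm_sq_curve, h.inner_curve]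
  simp_rw [e]
  have hr := h.continuous
  have hc : Continuous fun y' => √(r 0 - 2 * r (y - y') + r 0) := by fun_prop
  have := hc.tendsto y
  have e0 : r 0 - 2 * r 0 + r 0 = 0 := by ring
  simpa [e0] using this

variable {k k' : ℝ → ℝ}

lemma integrable_smul_curve (h : IsStationaryGaussian ζ r P) (hk : Integrable k) (x : ℝ) :
    Integrable (fun y => k y • h.curve (x - y)) := by
  refine (hk.norm.mul_const √(r 0)).mono' ?_ (ae_of_all _ fun y => ?_)
  · have := h.continuous_curve
    exact hk.1.smul (Continuous.aestronglyMeasurable (by fun_prop))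
  · rw [norm_smul, ← h.norm_sq_curve (x - y), Real.sqrt_sq (norm_nonneg _)]

/-- The convolution of the process with a kernel, as a Bochner integral in `L²`. -/
noncomputable def convolution (h : IsStationaryGaussian ζ r P) (k : ℝ → ℝ) (x : ℝ) : Lp ℝ 2 P :=
  ∫ y, k y • h.curve (x - y)

/-- The integral can be formed inside the closed span, which is complete, and the inclusion commutes
with integration. -/
lemma convolution_mem (h : IsStationaryGaussian ζ r P) (hk : Integrable k) (x : ℝ) :
    h.convolution k x ∈ closedSpan h.curve := by
  have hcl : IsClosed (closedSpan h.curve : Set (Lp ℝ 2 P)) :=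
    Submodule.isClosed_topologicalClosure _
  have : CompleteSpace (closedSpan h.curve) := hcl.completeSpace_coe
  let c : ℝ → closedSpan h.curve := fun y => ⟨h.curve y, mem_closedSpan _ y⟩
  have hc : Continuous c := h.continuous_curve.subtype_mk _
  have hi : Integrable (fun y => k y • c (x - y)) := by
    refine (hk.norm.mul_const √(r 0)).mono' ?_ (ae_of_all _ fun y => ?_)
    · exact hk.1.smul (Continuous.aestronglyMeasurable (by fun_prop))
    · rw [norm_smul, ← h.norm_sq_curve (x - y), Real.sqrt_sq (norm_nonneg _)]
      rfl
  have := (closedSpan h.curve).subtypeL.integral_comp_comm hi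
  rw [convolution]
  change ∫ y, (closedSpan h.curve).subtypeL (k y • c (x - y)) ∈ _
  rw [this]
  exact (∫ y, k y • c (x - y)).2

lemma inner_convolution (h : IsStationaryGaussian ζ r P) (hk : Integrable k) (hk' : Integrable k')
    (x x' : ℝ) :
    inner ℝ (h.convolution k x) (h.convolution k' x') =
      ∫ y', k' y' * ∫ y, k y * r ((x' - y') - (x - y)) := by
  rw [convolution, convolution, ← integral_inner (h.integrable_smul_curve hk' x')]
  refine integral_congr_ae (ae_of_all _ fun y' => ?_)
  simp only
  rw [inner_smul_right, real_inner_comm, ← integral_inner (h.integrable_smul_curve hk x)]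
  congr 1
  refine integral_congr_ae (ae_of_all _ fun y => ?_)
  simp only
  rw [inner_smul_right, real_inner_comm, h.inner_curve]

variable [IsProbabilityMeasure P]

lemma integral_abs_le (h : IsStationaryGaussian ζ r P) (y : ℝ) :
    ∫ ω, ‖ζ y ω‖ ∂P ≤ (1 + r 0) / 2 := by
  have hsq : Integrable (fun ω => ζ y ω * ζ y ω) P := (h.memLp y).integrable_mul (h.memLp y)
  have h1 : ∫ ω, (1 + ζ y ω * ζ y ω) / 2 ∂P = (1 + r 0) / 2 := by
    rw [integral_div, integral_add (integrable_const _) hsq, h.covariance]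
    simp
  rw [← h1]
  refine integral_mono ((h.memLp y).integrable one_le_two).norm
    (((integrable_const _).add hsq).div_const 2) fun ω => ?_
  simp only [Real.norm_eq_abs]
  nlinarith [sq_nonneg (|ζ y ω| - 1), sq_abs (ζ y ω)]

lemma integrable_prod (h : IsStationaryGaussian ζ r P) (hk : Integrable k) (x : ℝ) :
    Integrable (fun p : Ω × ℝ => ζ (x - p.2) p.1 * k p.2) (P.prod volume) := by
  have hm : Measurable fun p : Ω × ℝ => ζ (x - p.2) p.1 :=
    h.measurable.comp ((measurable_const.sub measurable_snd).prodMk measurable_fst)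
  have hm' : AEStronglyMeasurable (fun p : Ω × ℝ => ζ (x - p.2) p.1 * k p.2) (P.prod volume) :=
    hm.aestronglyMeasurable.mul hk.1.comp_snd
  rw [integrable_prod_iff' hm']
  refine ⟨ae_of_all _ fun y => ((h.memLp (x - y)).integrable one_le_two).mul_const (k y), ?_⟩
  refine (hk.norm.const_mul ((1 + r 0) / 2)).mono' hm'.norm.prod_swap.integral_prod_right'
    (ae_of_all _ fun y => ?_)
  rw [Real.norm_of_nonneg (integral_nonneg fun _ => norm_nonneg _)]
  simp only [norm_mul]
  rw [integral_mul_const]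
  gcongr
  exact h.integral_abs_le _

/-- Both sides have the same integral over every measurable event: Fubini treats the pathwise
integral, and pairing with an indicator commutes with the Bochner integral. -/
lemma integral_ae_eq_convolution (h : IsStationaryGaussian ζ r P) (hk : Integrable k) (x : ℝ) :
    (fun ω => ∫ y, ζ (x - y) ω * k y) =ᵐ[P] h.convolution k x := by
  have hp := h.integrable_prod hk x
  refine Integrable.ae_eq_of_forall_setIntegral_eq _ _ hp.integral_prod_left
    ((Lp.memLp _).integrable one_le_two) fun s hs hμ => ?_
  have hp' : Integrable (Function.uncurry fun (ω : Ω) (y : ℝ) => ζ (x - y) ω * k y)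
      ((P.restrict s).prod volume) := by
    have : (P.restrict s).prod (volume : Measure ℝ) = (P.prod volume).restrict (s ×ˢ Set.univ) := by
      rw [← Measure.prod_restrict, Measure.restrict_univ]
    rw [this]
    exact hp.restrict
  rw [integral_integral_swap hp', ← L2.inner_indicatorConstLp_one (𝕜 := ℝ) hs hμ.ne, convolution,
    ← integral_inner (h.integrable_smul_curve hk x)]
  refine integral_congr_ae (ae_of_all _ fun y => ?_)
  simp only
  rw [inner_smul_right, L2.inner_indicatorConstLp_one, integral_mul_const, mul_comm]
  congr 1
  exact integral_congr_ae (ae_restrict_of_ae ((h.memLp (x - y)).coeFn_toLp.symm))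

end IsStationaryGaussian

end PathIntegral

/-! ### Covariance of the solution in spectral form. -/

section SpectralCalculus

lemma integral_mul_integral_exp {k : ℝ → ℝ} {f : ℝ → ℂ} (hk : Integrable k) (hf : Integrable f)
    (a s : ℝ) :
    ∫ y : ℝ, (k y : ℂ) * ∫ l : ℝ, Complex.exp (Complex.I * ((a + s * y : ℝ) : ℂ) * l) * f l =
      ∫ l : ℝ, Complex.exp (Complex.I * a * l) *
        ((∫ y : ℝ, (k y : ℂ) * Complex.exp (Complex.I * ((s * l : ℝ) : ℂ) * y)) * f l) := by
  have hi : Integrable (Function.uncurry fun y l : ℝ => (k y : ℂ) *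
      (Complex.exp (Complex.I * ((a + s * y : ℝ) : ℂ) * l) * f l)) (volume.prod volume) := by
    refine (hk.ofReal.mul_prod hf).norm.mono' ?_ (ae_of_all _ fun p => ?_)
    · refine hk.ofReal.1.comp_fst.mul (AEStronglyMeasurable.mul ?_ hf.1.comp_snd)
      exact Continuous.aestronglyMeasurable (by fun_prop)
    · simp only [Function.uncurry, norm_mul, norm_exp_I_mul_mul, one_mul]
      rfl
  simp_rw [← integral_const_mul]
  rw [integral_integral_swap hi]
  refine integral_congr_ae (ae_of_all _ fun l => ?_)
  simp only
  rw [← integral_mul_const, ← integral_const_mul]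
  refine integral_congr_ae (ae_of_all _ fun y => ?_)
  simp only
  have : Complex.exp (Complex.I * ((a + s * y : ℝ) : ℂ) * l) =
      Complex.exp (Complex.I * a * l) * Complex.exp (Complex.I * ((s * l : ℝ) : ℂ) * y) := by
    rw [← Complex.exp_add]; congr 1; push_cast; ring
  rw [this]; ring

lemma integrable_exp_neg_mul_of_integrable {m : ℕ} (hm : Even m) {t : ℝ} (ht : 0 < t) {f : ℝ → ℂ}
    (hf : Integrable f) : Integrable fun l : ℝ => ((Real.exp (-t * l ^ m) : ℝ) : ℂ) * f l := by
  refine hf.norm.mono' ((Continuous.aestronglyMeasurable (by fun_prop)).mul hf.1)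
    (ae_of_all _ fun l => ?_)
  rw [norm_mul, Complex.norm_real, Real.norm_eq_abs, Real.abs_exp]
  refine mul_le_of_le_one_left (norm_nonneg _) (Real.exp_le_one_iff.2 ?_)
  nlinarith [hm.pow_nonneg l]

/-- Each convolution multiplies the spectral density by its symbol. The two kernel variables enter
the phase with slopes `1` and `-1`; evenness of `m` hides the sign, and the real part leaves the
cosine. -/
lemma integral_heatKernel_mul_heatKernel {m : ℕ} (hm : Even m) (hm0 : 0 < m) {t t' : ℝ}
    (ht : 0 < t) (ht' : 0 < t') {r f : ℝ → ℝ} (hf : Integrable f)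
    (hr : ∀ x : ℝ, ∫ l : ℝ, Complex.exp (Complex.I * x * l) * (f l : ℂ) = (r x : ℂ)) (x x' : ℝ) :
    ∫ y', heatKernel m t' y' * ∫ y, heatKernel m t y * r ((x' - y') - (x - y)) =
      ∫ l, Real.cos ((x' - x) * l) * Real.exp (-(t + t') * l ^ m) * f l := by
  have h1 (y' : ℝ) : ((∫ y, heatKernel m t y * r ((x' - y') - (x - y)) : ℝ) : ℂ) =
      ∫ l : ℝ, Complex.exp (Complex.I * (((x' - x) + (-1) * y' : ℝ) : ℂ) * l) *
        (((Real.exp (-t * l ^ m) : ℝ) : ℂ) * f l) := by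
    have h := integral_mul_integral_exp (integrable_heatKernel hm hm0 ht) hf.ofReal
      ((x' - x) + (-1) * y') 1
    simp only [one_mul, integral_heatKernel_mul_exp hm hm0 ht] at h
    refine Eq.trans ?_ h
    rw [← integral_complex_ofReal]
    refine integral_congr_ae (ae_of_all _ fun y => ?_)
    simp only
    erw [hr]
    rw [← Complex.ofReal_mul]
    congr 3
    ring
  have h2 : ((∫ y', heatKernel m t' y' * ∫ y, heatKernel m t y * r ((x' - y') - (x - y)) : ℝ) : ℂ) =
      ∫ l : ℝ, Complex.exp (Complex.I * ((x' - x : ℝ) : ℂ) * l) *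
        (((Real.exp (-t' * l ^ m) : ℝ) : ℂ) * (((Real.exp (-t * l ^ m) : ℝ) : ℂ) * f l)) := by
    have h := integral_mul_integral_exp (integrable_heatKernel hm hm0 ht')
      (integrable_exp_neg_mul_of_integrable hm ht hf.ofReal) (x' - x) (-1)
    simp only [integral_heatKernel_mul_exp hm hm0 ht'] at h
    rw [← integral_complex_ofReal]
    refine Eq.trans (integral_congr_ae (ae_of_all _ fun y' => ?_)) (h.trans ?_)
    · simp only
      rw [Complex.ofReal_mul, h1]
      rfl
    · simp [hm.neg_pow]
  have hi : Integrable fun l : ℝ => Complex.exp (Complex.I * ((x' - x : ℝ) : ℂ) * l) *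
        (((Real.exp (-t' * l ^ m) : ℝ) : ℂ) * (((Real.exp (-t * l ^ m) : ℝ) : ℂ) * f l)) :=
    integrable_exp_mul (integrable_exp_neg_mul_of_integrable hm ht'
      (integrable_exp_neg_mul_of_integrable hm ht hf.ofReal)) _
  have h3 := congrArg Complex.re h2
  rw [Complex.ofReal_re] at h3
  rw [h3]
  refine (integral_re hi).symm.trans (integral_congr_ae (ae_of_all _ fun l => ?_))
  have e1 : Complex.I * ((x' - x : ℝ) : ℂ) * l = (((x' - x) * l : ℝ) : ℂ) * Complex.I := by
    push_cast; ring
  simp only [RCLike.re_eq_complex_re]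
  rw [e1, ← Complex.ofReal_mul, ← Complex.ofReal_mul, Complex.re_mul_ofReal,
    Complex.exp_ofReal_mul_I_re]
  have e2 : Real.exp (-(t + t') * l ^ m) = Real.exp (-t' * l ^ m) * Real.exp (-t * l ^ m) := by
    rw [← Real.exp_add]; ring_nf
  rw [e2]
  ring

end SpectralCalculus

/-! ### Concentration of the rescaled spectral integral at zero. -/

section Scaling

variable {m : ℕ} {T : ℝ} {f : ℝ → ℝ}

lemma tendsto_integral_comp_mul_of_nonneg {φ : ℝ → ℝ} (h0 : ∀ x, 0 ≤ φ x) (hpos : 0 < ∫ x, φ x)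
    (hdecay : Tendsto (fun x => ‖x‖ * φ x) (Bornology.cobounded ℝ) (𝓝 0)) (hf : Integrable f)
    (hc : ContinuousAt f 0) :
    Tendsto (fun c : ℝ => c * ∫ l, φ (c * l) * f l) atTop (𝓝 (f 0 * ∫ x, φ x)) := by
  set J := ∫ x, φ x
  have h := tendsto_integral_comp_smul_smul_of_integrable (μ := volume) (φ := fun x => φ x / J)
    (fun x => div_nonneg (h0 x) hpos.le) (by rw [integral_div]; exact div_self hpos.ne')
    (by simpa [mul_div_assoc] using hdecay.div_const J) hf hc
  clear_value J
  refine (h.mul_const J).congr fun c => ?_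
  simp only [Module.finrank_self, pow_one, smul_eq_mul]
  rw [← integral_const_mul, ← integral_mul_const]
  refine integral_congr_ae (ae_of_all _ fun l => ?_)
  simp only
  field_simp

lemma norm_mul_exp_le (hm : Even m) (hm0 : 0 < m) (hT : 0 < T) (x : ℝ) :
    ‖x‖ * Real.exp (-T * x ^ m) ≤ Real.exp T * T⁻¹ * ‖x‖⁻¹ := by
  -- At `x = 0` the convention `0⁻¹ = 0` makes both sides vanish.
  rcases eq_or_ne x 0 with rfl | hx
  · simp
  have hx' : 0 < ‖x‖ := norm_pos_iff.2 hx
  have h1 : Real.exp (-T * x ^ 2) ≤ T⁻¹ * ‖x‖⁻¹ * ‖x‖⁻¹ := by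
    rw [neg_mul, Real.exp_neg, mul_assoc, ← mul_inv, ← mul_inv]
    apply inv_anti₀ (by positivity)
    have := Real.add_one_le_exp (T * x ^ 2)
    have e : ‖x‖ * ‖x‖ = x ^ 2 := by rw [Real.norm_eq_abs, abs_mul_abs_self, pow_two]
    rw [e]; linarith
  calc _ ≤ ‖x‖ * (Real.exp T * (T⁻¹ * ‖x‖⁻¹ * ‖x‖⁻¹)) := by
        gcongr
        exact (exp_neg_mul_pow_le hm hm0 hT x).trans (by gcongr)
    _ = _ := by field_simp

lemma tendsto_norm_mul_exp (hm : Even m) (hm0 : 0 < m) (hT : 0 < T) :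
    Tendsto (fun x : ℝ => ‖x‖ * Real.exp (-T * x ^ m)) (Bornology.cobounded ℝ) (𝓝 0) := by
  have h : Tendsto (fun x : ℝ => Real.exp T * T⁻¹ * ‖x‖⁻¹) (Bornology.cobounded ℝ) (𝓝 0) := by
    simpa using ((tendsto_norm_cobounded_atTop (E := ℝ)).inv_tendsto_atTop).const_mul
      (Real.exp T * T⁻¹)
  exact squeeze_zero (fun x => by positivity) (norm_mul_exp_le hm hm0 hT) h

lemma integral_exp_neg_mul_pow_pos (hm : Even m) (hm0 : 0 < m) (hT : 0 < T) :
    0 < ∫ l : ℝ, Real.exp (-T * l ^ m) :=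
  integral_exp_pos (integrable_exp_neg_mul_pow hm hm0 hT)

lemma integrable_cos_mul_exp_neg_mul_pow (hm : Even m) (hm0 : 0 < m) (hT : 0 < T) (d : ℝ) :
    Integrable fun l : ℝ => Real.cos (d * l) * Real.exp (-T * l ^ m) :=
  (integrable_exp_neg_mul_pow hm hm0 hT).mono' (by fun_prop) (ae_of_all _ fun l => by
    rw [norm_mul, Real.norm_eq_abs, Real.norm_eq_abs, Real.abs_exp]
    exact mul_le_of_le_one_left (Real.exp_pos _).le (Real.abs_cos_le_one _))

/-- The approximate-identity argument needs a nonnegative profile of positive mass, and the cosine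
changes sign. Hence the splitting `cos · E = (2 + cos) · E - 2 · E` with `E` the exponential; the
constant `2` keeps the first profile above `E`. -/
lemma tendsto_scaled_integral (hm : Even m) (hm0 : 0 < m) (hT : 0 < T) (hf : Integrable f)
    (hc : ContinuousAt f 0) (d : ℝ) :
    Tendsto (fun c : ℝ => c * ∫ l, Real.cos (d * (c * l)) * Real.exp (-T * (c * l) ^ m) * f l) atTop
      (𝓝 (f 0 * ∫ l, Real.cos (d * l) * Real.exp (-T * l ^ m))) := by
  have hE := integrable_exp_neg_mul_pow hm hm0 hT
  have hC := integrable_cos_mul_exp_neg_mul_pow hm hm0 hT d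
  have h1 := tendsto_integral_comp_mul_of_nonneg (φ := fun l => 2 * Real.exp (-T * l ^ m))
    (fun l => by positivity)
    (by rw [integral_const_mul]; have := integral_exp_neg_mul_pow_pos hm hm0 hT; positivity)
    (by simpa [mul_left_comm] using (tendsto_norm_mul_exp hm hm0 hT).const_mul 2) hf hc
  have hge : ∀ l, Real.exp (-T * l ^ m) ≤ (2 + Real.cos (d * l)) * Real.exp (-T * l ^ m) :=
    fun l => le_mul_of_one_le_left (Real.exp_pos _).le (by linarith [Real.neg_one_le_cos (d * l)])
  have hI2 : Integrable fun l => (2 + Real.cos (d * l)) * Real.exp (-T * l ^ m) := by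
    simp only [add_mul]; exact (hE.const_mul 2).add hC
  have h2 := tendsto_integral_comp_mul_of_nonneg
    (φ := fun l => (2 + Real.cos (d * l)) * Real.exp (-T * l ^ m))
    (fun l => (Real.exp_pos _).le.trans (hge l))
    ((integral_exp_neg_mul_pow_pos hm hm0 hT).trans_le (integral_mono hE hI2 hge))
    (squeeze_zero (fun l => mul_nonneg (norm_nonneg _) ((Real.exp_pos _).le.trans (hge l)))
      (fun l => by
        have : 2 + Real.cos (d * l) ≤ 3 := by linarith [Real.cos_le_one (d * l)]
        calc _ ≤ ‖l‖ * (3 * Real.exp (-T * l ^ m)) := by gcongr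
          _ = 3 * (‖l‖ * Real.exp (-T * l ^ m)) := by ring)
      (by simpa using (tendsto_norm_mul_exp hm hm0 hT).const_mul 3)) hf hc
  have hb : ∀ {g : ℝ → ℝ} (K : ℝ), Continuous g → (∀ l, ‖g l‖ ≤ K) →
      Integrable fun l => g l * f l := fun {g} K hg hK =>
    (hf.norm.const_mul K).mono' (hg.aestronglyMeasurable.mul hf.1) (ae_of_all _ fun l => by
      rw [norm_mul]; exact mul_le_mul_of_nonneg_right (hK l) (norm_nonneg _))
  have hexp1 : ∀ l : ℝ, Real.exp (-T * l ^ m) ≤ 1 := fun l =>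
    Real.exp_le_one_iff.2 (by nlinarith [hm.pow_nonneg l])
  have e := h2.sub h1
  refine Tendsto.congr (fun c => ?_) (e.trans_eq ?_)
  · rw [← mul_sub, ← integral_sub]
    · congr 1
      refine integral_congr_ae (ae_of_all _ fun l => ?_)
      simp only; ring
    · refine hb 3 (by fun_prop) fun l => ?_
      rw [norm_mul, Real.norm_eq_abs, Real.norm_eq_abs, Real.abs_exp, abs_of_nonneg
        (by linarith [Real.neg_one_le_cos (d * (c * l))])]
      nlinarith [Real.cos_le_one (d * (c * l)), Real.neg_one_le_cos (d * (c * l)),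
        hexp1 (c * l), Real.exp_pos (-T * (c * l) ^ m)]
    · refine hb 2 (by fun_prop) fun l => ?_
      rw [norm_mul, Real.norm_eq_abs, Real.norm_eq_abs, Real.abs_exp, abs_two]
      linarith [hexp1 (c * l)]
  · rw [← mul_sub, ← integral_sub hI2 (hE.const_mul 2)]
    congr 3
    funext l
    ring

end Scaling
-- The stochastic integral and its isometry.
section StochasticIntegral

variable {Ω : Type*} [MeasurableSpace Ω] {P : Measure Ω}

/-- A random set function with square integrable values which is orthogonal with respect to
Lebesgue measure. -/
structure IsOrthogonalFamily (V : Set ℝ → Ω → ℂ) (P : Measure Ω) : Prop where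
  memLp : ∀ A : Set ℝ, MeasurableSet A → volume A < ∞ → MemLp (V A) 2 P
  covariance : ∀ A B : Set ℝ, MeasurableSet A → volume A < ∞ → MeasurableSet B → volume B < ∞ →
    ∫ ω, V A ω * (starRingEnd ℂ) (V B ω) ∂P = ((volume.real (A ∩ B) : ℝ) : ℂ)

/-- The deterministic model: integrating a simple function against indicators returns that function,
so formulas valid for all orthogonal families also compute inner products in `L²(ℝ)`. -/
lemma isOrthogonalFamily_indicator :
    IsOrthogonalFamily (fun A : Set ℝ => A.indicator fun _ => (1 : ℂ)) volume where
  memLp A hA hfin := memLp_indicator_const 2 hA 1 (Or.inr hfin.ne)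
  covariance A B hA _ hB _ := by
    have e : ∀ l : ℝ, A.indicator (fun _ => (1 : ℂ)) l *
        (starRingEnd ℂ) (B.indicator (fun _ => (1 : ℂ)) l) =
        (A ∩ B).indicator (fun _ => (1 : ℂ)) l := by
      intro l
      by_cases h1 : l ∈ A <;> by_cases h2 : l ∈ B <;> simp [h1, h2]
    simp_rw [e]
    rw [integral_indicator (hA.inter hB)]
    simp [Measure.real]

lemma IsSymmetricWhiteNoise.isOrthogonalFamily {W : Set ℝ → Ω → ℂ}
    (hW : IsSymmetricWhiteNoise W P) : IsOrthogonalFamily W P where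
  memLp A hA hfin := (hW.gaussian.hasGaussianLaw_eval ⟨A, hA, hfin⟩).memLp_two
  covariance := hW.covariance

open Classical in
/-- The values of a set function as elements of `L²`. -/
noncomputable def setLp (V : Set ℝ → Ω → ℂ) (P : Measure Ω) (A : Set ℝ) : Lp ℂ 2 P :=
  if h : MemLp (V A) 2 P then h.toLp else 0

/-- The integral of a simple function as an element of `L²`. -/
noncomputable def simpleLp (V : Set ℝ → Ω → ℂ) (P : Measure Ω) (s : SimpleFunc ℝ ℂ) : Lp ℂ 2 P :=
  ∑ z ∈ s.range, z • setLp V P (s ⁻¹' {z})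

lemma volume_preimage_lt_top {s : SimpleFunc ℝ ℂ} (hs : MemLp s 2 volume) {z : ℂ} (hz : z ≠ 0) :
    volume (s ⁻¹' {z}) < ∞ :=
  SimpleFunc.measure_preimage_lt_top_of_memLp two_ne_zero ENNReal.ofNat_ne_top s hs z hz

variable {V : Set ℝ → Ω → ℂ}

namespace IsOrthogonalFamily

lemma coeFn_setLp (hV : IsOrthogonalFamily V P) {A : Set ℝ} (hA : MeasurableSet A)
    (hfin : volume A < ∞) : setLp V P A =ᵐ[P] V A := by
  rw [setLp, dif_pos (hV.memLp A hA hfin)]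
  exact MemLp.coeFn_toLp _

lemma inner_setLp (hV : IsOrthogonalFamily V P) {A B : Set ℝ} (hA : MeasurableSet A)
    (hAf : volume A < ∞) (hB : MeasurableSet B) (hBf : volume B < ∞) :
    inner ℂ (setLp V P A) (setLp V P B) = ((volume.real (B ∩ A) : ℝ) : ℂ) := by
  rw [← hV.covariance B A hB hBf hA hAf, L2.inner_def]
  refine integral_congr_ae ?_
  filter_upwards [hV.coeFn_setLp hA hAf, hV.coeFn_setLp hB hBf] with ω h1 h2
  rw [h1, h2, RCLike.inner_apply]

lemma coeFn_simpleLp (hV : IsOrthogonalFamily V P) {s : SimpleFunc ℝ ℂ} (hs : MemLp s 2 volume) :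
    simpleLp V P s =ᵐ[P] simpleStochInt V s := by
  have h : ∀ᵐ ω ∂P, ∀ z : s.range, (⇑((z : ℂ) • setLp V P (s ⁻¹' {(z : ℂ)})) : Ω → ℂ) ω =
      z * V (s ⁻¹' {(z : ℂ)}) ω := by
    rw [ae_all_iff]
    rintro ⟨z, hz⟩
    -- The fibre over `0` may have infinite measure, where `V` is uncontrolled; its coefficient
    -- removes it.
    rcases eq_or_ne z 0 with rfl | hz0
    · filter_upwards [Lp.coeFn_zero ℂ 2 P] with ω h
      simpa only [zero_smul, zero_mul, Pi.zero_apply] using h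
    · filter_upwards [Lp.coeFn_smul z (setLp V P (s ⁻¹' {z})),
        hV.coeFn_setLp (s.measurableSet_fiber z) (volume_preimage_lt_top hs hz0)] with ω h1 h2
      simp only [h1, Pi.smul_apply, h2, smul_eq_mul]
  filter_upwards [coeFn_finsetSum s.range fun z => z • setLp V P (s ⁻¹' {z}), h] with ω h1 h2
  rw [simpleLp, h1, simpleStochInt]
  exact Finset.sum_congr rfl fun z hz => h2 ⟨z, hz⟩

lemma memLp_simpleStochInt (hV : IsOrthogonalFamily V P) {s : SimpleFunc ℝ ℂ}
    (hs : MemLp s 2 volume) : MemLp (simpleStochInt V s) 2 P :=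
  (memLp_congr_ae (hV.coeFn_simpleLp hs)).1 (Lp.memLp _)

lemma simpleLp_eq_toLp (hV : IsOrthogonalFamily V P) {s : SimpleFunc ℝ ℂ}
    (hs : MemLp s 2 volume) : simpleLp V P s = (hV.memLp_simpleStochInt hs).toLp := by
  refine Lp.ext ?_
  filter_upwards [hV.coeFn_simpleLp hs, (hV.memLp_simpleStochInt hs).coeFn_toLp] with ω h1 h2
  rw [h1, h2]

lemma inner_simpleLp (hV : IsOrthogonalFamily V P) {s s' : SimpleFunc ℝ ℂ}
    (hs : MemLp s 2 volume) (hs' : MemLp s' 2 volume) :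
    inner ℂ (simpleLp V P s) (simpleLp V P s') = ∑ z ∈ s.range, ∑ z' ∈ s'.range,
      (starRingEnd ℂ) z * (z' * ((volume.real (s' ⁻¹' {z'} ∩ s ⁻¹' {z}) : ℝ) : ℂ)) := by
  rw [simpleLp, simpleLp, sum_inner]
  refine Finset.sum_congr rfl fun z _ => ?_
  rw [inner_sum]
  refine Finset.sum_congr rfl fun z' _ => ?_
  rw [inner_smul_left, inner_smul_right]
  rcases eq_or_ne z 0 with rfl | hz
  · simp
  rcases eq_or_ne z' 0 with rfl | hz'
  · simp
  rw [hV.inner_setLp (s.measurableSet_fiber z) (volume_preimage_lt_top hs hz)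
    (s'.measurableSet_fiber z') (volume_preimage_lt_top hs' hz')]

end IsOrthogonalFamily

lemma simpleStochInt_indicator (s : SimpleFunc ℝ ℂ) :
    simpleStochInt (fun A : Set ℝ => A.indicator fun _ => (1 : ℂ)) s = s := by
  funext l
  rw [simpleStochInt, Finset.sum_eq_single (s l)]
  · simp
  · intro z _ hz
    simp [Ne.symm hz]
  · intro h
    exact absurd (s.mem_range_self l) h

/-- Both inner products are the same double sum over overlaps of fibres, once for `V` and once for
indicators. No additivity of `V` enters. -/
lemma IsOrthogonalFamily.inner_simpleLp_eq (hV : IsOrthogonalFamily V P) {s s' : SimpleFunc ℝ ℂ}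
    (hs : MemLp s 2 volume) (hs' : MemLp s' 2 volume) :
    inner ℂ (simpleLp V P s) (simpleLp V P s') = inner ℂ hs.toLp hs'.toLp := by
  have h (s : SimpleFunc ℝ ℂ) (hs : MemLp s 2 volume) : hs.toLp =
      simpleLp (fun A : Set ℝ => A.indicator fun _ => (1 : ℂ)) volume s := by
    rw [isOrthogonalFamily_indicator.simpleLp_eq_toLp hs]
    simp only [simpleStochInt_indicator]
  rw [h s hs, h s' hs', hV.inner_simpleLp hs hs',
    isOrthogonalFamily_indicator.inner_simpleLp hs hs']

lemma IsOrthogonalFamily.norm_simpleLp_sub (hV : IsOrthogonalFamily V P) {s s' : SimpleFunc ℝ ℂ}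
    (hs : MemLp s 2 volume) (hs' : MemLp s' 2 volume) :
    ‖simpleLp V P s - simpleLp V P s'‖ = ‖hs.toLp - hs'.toLp‖ := by
  rw [← sq_eq_sq₀ (norm_nonneg _) (norm_nonneg _), @norm_sub_sq ℂ, @norm_sub_sq ℂ,
    hV.inner_simpleLp_eq hs hs', norm_sq_eq_re_inner (𝕜 := ℂ) (simpleLp V P s),
    norm_sq_eq_re_inner (𝕜 := ℂ) (simpleLp V P s'), hV.inner_simpleLp_eq hs hs,
    hV.inner_simpleLp_eq hs' hs', ← norm_sq_eq_re_inner (𝕜 := ℂ), ← norm_sq_eq_re_inner (𝕜 := ℂ)]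

/-- Simple approximations of `g` are Cauchy in `L²(ℝ)`, the isometry makes their integrals Cauchy,
and completeness supplies the limit. -/
lemma IsOrthogonalFamily.exists_isStochInt (hV : IsOrthogonalFamily V P) {g : ℝ → ℂ}
    (hg : MemLp g 2 volume) : ∃ X, IsStochInt V P g X := by
  have hex (n : ℕ) : ∃ s : SimpleFunc ℝ ℂ, eLpNorm (g - ⇑s) 2 volume < ((n : ℝ≥0∞) + 1)⁻¹ ∧
      MemLp s 2 volume :=
    hg.exists_simpleFunc_eLpNorm_sub_lt ENNReal.ofNat_ne_top (by simp)
  choose s hs hmem using hex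
  have h0 : Tendsto (fun n => eLpNorm (fun l : ℝ => s n l - g l) 2 volume) atTop (𝓝 0) := by
    have hinv : Tendsto (fun n : ℕ => ((n : ℝ≥0∞) + 1)⁻¹) atTop (𝓝 0) := by
      have := (tendsto_add_atTop_iff_nat (f := fun n : ℕ => ((n : ℝ≥0∞))⁻¹) 1).2
        ENNReal.tendsto_inv_nat_nhds_zero
      simpa using this
    refine tendsto_of_tendsto_of_tendsto_of_le_of_le tendsto_const_nhds hinv
      (fun _ => zero_le) fun n => ?_
    refine le_trans (le_of_eq ?_) (hs n).le
    exact eLpNorm_sub_comm _ _ _ _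
  have hlim : Tendsto (fun n => (hmem n).toLp) atTop (𝓝 hg.toLp) :=
    (Lp.tendsto_Lp_iff_tendsto_eLpNorm'' _ hmem g hg).2 h0
  have hcau : CauchySeq fun n => simpleLp V P (s n) := by
    have := hlim.cauchySeq
    rw [Metric.cauchySeq_iff] at this ⊢
    intro ε hε
    obtain ⟨N, hN⟩ := this ε hε
    refine ⟨N, fun a ha b hb => ?_⟩
    rw [dist_eq_norm, hV.norm_simpleLp_sub (hmem a) (hmem b), ← dist_eq_norm]
    exact hN a ha b hb
  obtain ⟨X, hX⟩ := cauchySeq_tendsto_of_complete hcau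
  refine ⟨X, Lp.aestronglyMeasurable X, s, hmem, h0, ?_⟩
  refine ((Lp.tendsto_Lp_iff_tendsto_eLpNorm' _ _).1 hX).congr fun n => ?_
  refine eLpNorm_congr_ae ?_
  filter_upwards [hV.coeFn_simpleLp (hmem n)] with ω h
  simp [h]

variable {g h : ℝ → ℂ} {X Y : Ω → ℂ}

lemma IsOrthogonalFamily.memLp_of_isStochInt (hV : IsOrthogonalFamily V P)
    (hX : IsStochInt V P g X) : MemLp X 2 P := by
  obtain ⟨hm, s, hs, -, hlim⟩ := hX
  -- One approximant at finite distance suffices: `X` is that approximant minus the error.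
  obtain ⟨n, hn⟩ := (hlim.eventually_lt_const (u := 1) zero_lt_one).exists
  have h1 := hV.memLp_simpleStochInt (hs n)
  have h2 : MemLp (fun ω => simpleStochInt V (s n) ω - X ω) 2 P :=
    ⟨h1.1.sub hm, hn.trans ENNReal.one_lt_top⟩
  have := h1.sub h2
  refine (memLp_congr_ae (ae_of_all _ fun ω => ?_)).1 this
  simp

lemma IsOrthogonalFamily.exists_tendsto_of_isStochInt (hV : IsOrthogonalFamily V P)
    (hg : MemLp g 2 volume) (hX : IsStochInt V P g X) :
    ∃ (s : ℕ → SimpleFunc ℝ ℂ) (hs : ∀ n, MemLp (s n) 2 volume),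
      Tendsto (fun n => (hs n).toLp) atTop (𝓝 hg.toLp) ∧
      Tendsto (fun n => simpleLp V P (s n)) atTop (𝓝 (hV.memLp_of_isStochInt hX).toLp) := by
  obtain ⟨s, hs, h1, h2⟩ := hX.2
  refine ⟨s, hs, (Lp.tendsto_Lp_iff_tendsto_eLpNorm'' _ hs g hg).2 h1, ?_⟩
  simp_rw [fun n => hV.simpleLp_eq_toLp (hs n)]
  exact (Lp.tendsto_Lp_iff_tendsto_eLpNorm'' _ (fun n => hV.memLp_simpleStochInt (hs n)) X
    (hV.memLp_of_isStochInt hX)).2 h2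

lemma IsOrthogonalFamily.inner_of_isStochInt (hV : IsOrthogonalFamily V P)
    (hg : MemLp g 2 volume) (hh : MemLp h 2 volume) (hX : IsStochInt V P g X)
    (hY : IsStochInt V P h Y) :
    inner ℂ (hV.memLp_of_isStochInt hX).toLp (hV.memLp_of_isStochInt hY).toLp =
      inner ℂ hg.toLp hh.toLp := by
  obtain ⟨s, hs, h1, h2⟩ := hV.exists_tendsto_of_isStochInt hg hX
  obtain ⟨s', hs', h1', h2'⟩ := hV.exists_tendsto_of_isStochInt hh hY
  refine tendsto_nhds_unique (h2.inner h2') ?_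
  simp_rw [fun n => hV.inner_simpleLp_eq (hs n) (hs' n)]
  exact h1.inner h1'

/-- Independence of the approximating sequence: every inner product in the expansion of `‖X - Y‖²`
equals `⟪g, g⟫`, so the square vanishes. -/
lemma IsOrthogonalFamily.ae_eq_of_isStochInt (hV : IsOrthogonalFamily V P)
    (hg : MemLp g 2 volume) (hX : IsStochInt V P g X) (hY : IsStochInt V P g Y) : X =ᵐ[P] Y := by
  rw [← MemLp.toLp_eq_toLp_iff (hV.memLp_of_isStochInt hX) (hV.memLp_of_isStochInt hY),
    ← sub_eq_zero, ← norm_eq_zero, ← sq_eq_zero_iff, @norm_sub_sq ℂ,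
    norm_sq_eq_re_inner (𝕜 := ℂ) (hV.memLp_of_isStochInt hX).toLp,
    norm_sq_eq_re_inner (𝕜 := ℂ) (hV.memLp_of_isStochInt hY).toLp,
    hV.inner_of_isStochInt hg hg hX hY, hV.inner_of_isStochInt hg hg hX hX,
    hV.inner_of_isStochInt hg hg hY hY]
  ring

/-! ### Symmetry of the noise: real and Gaussian integrals. -/

section Symmetric

variable {W : Set ℝ → Ω → ℂ}

/-- The reflected conjugate `l ↦ conj (s (-l))` of a simple function. -/
noncomputable def reflectConj (s : SimpleFunc ℝ ℂ) : SimpleFunc ℝ ℂ :=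
  (s.comp (fun x : ℝ => -x) measurable_neg).map (starRingEnd ℂ)

lemma reflectConj_apply (s : SimpleFunc ℝ ℂ) (l : ℝ) :
    reflectConj s l = (starRingEnd ℂ) (s (-l)) := rfl

lemma IsSymmetricWhiteNoise.simpleStochInt_reflectConj (hW : IsSymmetricWhiteNoise W P)
    {s : SimpleFunc ℝ ℂ} (hs : MemLp s 2 volume) :
    ∀ᵐ ω ∂P, simpleStochInt W (reflectConj s) ω = (starRingEnd ℂ) (simpleStochInt W s ω) := by
  have h : ∀ᵐ ω ∂P, ∀ z : s.range, (z : ℂ) ≠ 0 →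
      W ((fun x : ℝ => -x) ⁻¹' (s ⁻¹' {(z : ℂ)})) ω = (starRingEnd ℂ) (W (s ⁻¹' {(z : ℂ)}) ω) := by
    rw [ae_all_iff]
    rintro ⟨z, hz⟩
    rcases eq_or_ne z 0 with rfl | hz0
    · simp
    · filter_upwards [hW.symmetric _ (s.measurableSet_fiber z) (volume_preimage_lt_top hs hz0)]
        with ω h _ using h
  filter_upwards [h] with ω h
  rw [simpleStochInt, simpleStochInt, map_sum]
  have hfib (z : ℂ) : reflectConj s ⁻¹' {(starRingEnd ℂ) z} =
      (fun x : ℝ => -x) ⁻¹' (s ⁻¹' {z}) := by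
    ext l
    simp only [Set.mem_preimage, Set.mem_singleton_iff, reflectConj_apply]
    exact (starRingEnd ℂ).injective.eq_iff
  symm
  refine Finset.sum_bij (fun z _ => (starRingEnd ℂ) z) ?_ ?_ ?_ ?_
  · intro z hz
    obtain ⟨l, rfl⟩ := SimpleFunc.mem_range.1 hz
    exact SimpleFunc.mem_range.2 ⟨-l, by simp [reflectConj_apply]⟩
  · intro z _ z' _ hzz
    exact (starRingEnd ℂ).injective hzz
  · intro z hz
    obtain ⟨l, rfl⟩ := SimpleFunc.mem_range.1 hz
    exact ⟨s (-l), s.mem_range_self _, rfl⟩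
  · intro z hz
    rw [hfib, map_mul]
    rcases eq_or_ne z 0 with rfl | hz0
    · simp
    · rw [h ⟨z, hz⟩ hz0]

lemma memLp_reflectConj {s : SimpleFunc ℝ ℂ} (hs : MemLp s 2 volume) :
    MemLp (reflectConj s) 2 volume := by
  have h1 : MemLp (s ∘ Neg.neg) 2 volume :=
    hs.comp_measurePreserving (Measure.measurePreserving_neg volume)
  exact h1.star

/-- Reflecting and conjugating the approximants preserves their distance to the Hermitian `g` and
conjugates their integrals. With uniqueness of the integral, this forces it to be real. -/
lemma IsSymmetricWhiteNoise.isStochInt_conj (hW : IsSymmetricWhiteNoise W P)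
    (hgm : AEStronglyMeasurable g volume) (hsymm : ∀ l, g (-l) = (starRingEnd ℂ) (g l))
    (hX : IsStochInt W P g X) : IsStochInt W P g fun ω => (starRingEnd ℂ) (X ω) := by
  obtain ⟨hm, s, hs, h1, h2⟩ := hX
  refine ⟨Complex.continuous_conj.comp_aestronglyMeasurable hm, fun n => reflectConj (s n),
    fun n => memLp_reflectConj (hs n), h1.congr fun n => ?_, h2.congr fun n => ?_⟩
  · have e := eLpNorm_comp_measurePreserving (p := 2) (f := (Neg.neg : ℝ → ℝ))
      (g := fun l => s n l - g l)
      ((s n).aestronglyMeasurable.sub hgm) (Measure.measurePreserving_neg volume)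
    rw [← e]
    refine eLpNorm_congr_norm_ae (ae_of_all _ fun l => ?_)
    rw [reflectConj_apply, ← RCLike.norm_conj, Function.comp, hsymm, map_sub, Complex.conj_conj]
  · refine eLpNorm_congr_norm_ae ?_
    filter_upwards [hW.simpleStochInt_reflectConj (hs n)] with ω h
    rw [h, ← map_sub, RCLike.norm_conj]

lemma IsSymmetricWhiteNoise.im_eq_zero (hW : IsSymmetricWhiteNoise W P)
    (hg : MemLp g 2 volume) (hsymm : ∀ l, g (-l) = (starRingEnd ℂ) (g l))
    (hX : IsStochInt W P g X) : ∀ᵐ ω ∂P, (X ω).im = 0 := by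
  filter_upwards [hW.isOrthogonalFamily.ae_eq_of_isStochInt hg hX
    (hW.isStochInt_conj hg.1 hsymm hX)] with ω h
  exact Complex.conj_eq_iff_im.1 h.symm

/-- The real part, as a map between `L²` spaces. -/
noncomputable def reLp (P : Measure Ω) : Lp ℂ 2 P →L[ℝ] Lp ℝ 2 P :=
  Complex.reCLM.compLpL 2 P

/-- The imaginary part, as a map between `L²` spaces. -/
noncomputable def imLp (P : Measure Ω) : Lp ℂ 2 P →L[ℝ] Lp ℝ 2 P :=
  Complex.imCLM.compLpL 2 P

lemma coeFn_reLp (X : Lp ℂ 2 P) : reLp P X =ᵐ[P] fun ω => (X ω).re :=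
  ContinuousLinearMap.coeFn_compLpL (p := 2) (μ := P) Complex.reCLM X

lemma coeFn_imLp (X : Lp ℂ 2 P) : imLp P X =ᵐ[P] fun ω => (X ω).im :=
  ContinuousLinearMap.coeFn_compLpL (p := 2) (μ := P) Complex.imCLM X

/-- The real and imaginary parts of a set function, on Borel sets of finite measure. -/
noncomputable def realParts (W : Set ℝ → Ω → ℂ) (P : Measure Ω)
    (a : {A : Set ℝ // MeasurableSet A ∧ volume A < ∞} × Bool) : Lp ℝ 2 P :=
  if a.2 then reLp P (setLp W P a.1) else imLp P (setLp W P a.1)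

lemma IsSymmetricWhiteNoise.coeFn_realParts (hW : IsSymmetricWhiteNoise W P)
    (a : {A : Set ℝ // MeasurableSet A ∧ volume A < ∞} × Bool) :
    realParts W P a =ᵐ[P] fun ω => if a.2 then (W a.1 ω).re else (W a.1 ω).im := by
  have h := hW.isOrthogonalFamily.coeFn_setLp a.1.2.1 a.1.2.2
  obtain ⟨A, b⟩ := a
  cases b
  · filter_upwards [h, coeFn_imLp (setLp W P A)] with ω h1 h2
    simp [realParts, h2, h1]
  · filter_upwards [h, coeFn_reLp (setLp W P A)] with ω h1 h2
    simp [realParts, h2, h1]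

lemma reLp_smul (z : ℂ) (X : Lp ℂ 2 P) :
    reLp P (z • X) = z.re • reLp P X - z.im • imLp P X := by
  refine Lp.ext ?_
  filter_upwards [coeFn_reLp (z • X), Lp.coeFn_smul z X, coeFn_reLp X, coeFn_imLp X,
    Lp.coeFn_sub (z.re • reLp P X) (z.im • imLp P X), Lp.coeFn_smul z.re (reLp P X),
    Lp.coeFn_smul z.im (imLp P X)] with ω h1 h2 h3 h4 h5 h6 h7
  rw [h1, h5, Pi.sub_apply, h6, h7, h2]
  simp [h3, h4]

/-- Complex coefficients mix real and imaginary parts of the noise, so both are among the generators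
of the real span. -/
lemma reLp_simpleLp_mem {s : SimpleFunc ℝ ℂ} (hs : MemLp s 2 volume) :
    reLp P (simpleLp W P s) ∈ closedSpan (realParts W P) := by
  rw [simpleLp, map_sum]
  refine Submodule.sum_mem _ fun z _ => ?_
  rcases eq_or_ne z 0 with rfl | hz
  · simp
  rw [reLp_smul]
  have h := mem_closedSpan (realParts W P)
  let A : {A : Set ℝ // MeasurableSet A ∧ volume A < ∞} :=
    ⟨s ⁻¹' {z}, s.measurableSet_fiber z, volume_preimage_lt_top hs hz⟩
  exact Submodule.sub_mem _ (Submodule.smul_mem _ _ (by simpa [realParts] using h (A, true)))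
    (Submodule.smul_mem _ _ (by simpa [realParts] using h (A, false)))

lemma IsSymmetricWhiteNoise.isGaussianProcess_realParts (hW : IsSymmetricWhiteNoise W P) :
    IsGaussianProcess (fun a => (realParts W P a : Ω → ℝ)) P := by
  have h : IsGaussianProcess (fun (a : {A : Set ℝ // MeasurableSet A ∧ volume A < ∞} × Bool)
      (ω : Ω) => if a.2 then (W a.1 ω).re else (W a.1 ω).im) P := by
    refine hW.gaussian.of_isGaussianProcess fun a => ⟨{a.1},
      (if a.2 then Complex.reCLM else Complex.imCLM).comp
        (ContinuousLinearMap.proj ⟨a.1, by simp⟩), fun ω => ?_⟩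
    obtain ⟨A, b⟩ := a
    cases b <;> simp
  exact h.congr fun a => (hW.coeFn_realParts a).symm

lemma IsSymmetricWhiteNoise.integral_realParts [IsProbabilityMeasure P]
    (hW : IsSymmetricWhiteNoise W P)
    (a : {A : Set ℝ // MeasurableSet A ∧ volume A < ∞} × Bool) :
    ∫ ω, realParts W P a ω ∂P = 0 := by
  rw [integral_congr_ae (hW.coeFn_realParts a)]
  obtain ⟨⟨A, hA, hf⟩, b⟩ := a
  have hi : Integrable (W A) P := (hW.isOrthogonalFamily.memLp A hA hf).integrable one_le_two
  have h0 := hW.mean_zero A hA hf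
  cases b
  · simpa [h0] using integral_im (𝕜 := ℂ) hi
  · simpa [h0] using integral_re (𝕜 := ℂ) hi

lemma IsSymmetricWhiteNoise.isCenteredGaussian [IsProbabilityMeasure P]
    (hW : IsSymmetricWhiteNoise W P) :
    ∀ X ∈ closedSpan (realParts W P), IsCenteredGaussian X := fun _ hX =>
  isCenteredGaussian_of_mem_closedSpan hW.isGaussianProcess_realParts hW.integral_realParts hX

lemma IsSymmetricWhiteNoise.reLp_mem (hW : IsSymmetricWhiteNoise W P) (hg : MemLp g 2 volume)
    (hX : IsStochInt W P g X) :
    reLp P (hW.isOrthogonalFamily.memLp_of_isStochInt hX).toLp ∈ closedSpan (realParts W P) := by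
  obtain ⟨s, hs, -, h2⟩ := hW.isOrthogonalFamily.exists_tendsto_of_isStochInt hg hX
  exact (Submodule.isClosed_topologicalClosure _).mem_of_tendsto
    (((reLp P).continuous.tendsto _).comp h2)
    (Eventually.of_forall fun n => reLp_simpleLp_mem (hs n))

/-- The isometry computes the expectation of `Y` times the conjugate of `X`; when `X` is real, the
real part of that product is the product of real parts, so only `g` has to be Hermitian. -/
lemma IsSymmetricWhiteNoise.integral_re_mul_re (hW : IsSymmetricWhiteNoise W P)
    (hg : MemLp g 2 volume) (hh : MemLp h 2 volume)
    (hsg : ∀ l, g (-l) = (starRingEnd ℂ) (g l))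
    (hX : IsStochInt W P g X) (hY : IsStochInt W P h Y) :
    ∫ ω, (X ω).re * (Y ω).re ∂P = (∫ l, h l * (starRingEnd ℂ) (g l)).re := by
  have hV := hW.isOrthogonalFamily
  have e := hV.inner_of_isStochInt hg hh hX hY
  rw [L2.inner_def, L2.inner_def] at e
  have e1 : ∫ l, h l * (starRingEnd ℂ) (g l) = ∫ l, inner ℂ (hg.toLp g l) (hh.toLp h l) := by
    refine integral_congr_ae ?_
    filter_upwards [hg.coeFn_toLp, hh.coeFn_toLp] with l h1 h2
    rw [h1, h2, RCLike.inner_apply]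
  rw [e1, ← e]
  have hi := L2.integrable_inner (𝕜 := ℂ) (hV.memLp_of_isStochInt hX).toLp
    (hV.memLp_of_isStochInt hY).toLp
  refine Eq.trans (integral_congr_ae ?_) (integral_re hi)
  filter_upwards [(hV.memLp_of_isStochInt hX).coeFn_toLp, (hV.memLp_of_isStochInt hY).coeFn_toLp,
    hW.im_eq_zero hg hsg hX] with ω h1 h2 h3
  rw [h1, h2, RCLike.inner_apply]
  simp [h3, mul_comm]

end Symmetric

end StochasticIntegral
-- Fox–Wright expansion of the limiting covariance.
section FoxWright

variable {m : ℕ} {T : ℝ}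

/-- Legendre duplication at half-integers; it turns the factorials of the cosine series into the
denominators `Γ(1/2 + l) l!`. -/
lemma factorial_two_mul_mul_sqrt_pi (l : ℕ) :
    ((2 * l).factorial : ℝ) * √Real.pi = 4 ^ l * l.factorial * Real.Gamma (1 / 2 + l) := by
  induction l with
  | zero => simpa using Real.Gamma_one_half_eq.symm
  | succ l ih =>
    have h : Real.Gamma (1 / 2 + (l + 1 : ℕ)) = (1 / 2 + l) * Real.Gamma (1 / 2 + l) := by
      rw [← Real.Gamma_add_one (by positivity)]
      congr 1
      push_cast; ring
    rw [h, show 2 * (l + 1) = 2 * l + 1 + 1 by ring, Nat.factorial_succ, Nat.factorial_succ,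
      Nat.factorial_succ l]
    push_cast
    linear_combination (2 * (l : ℝ) + 1 + 1) * (2 * l + 1) * ih

lemma integral_pow_mul_exp_neg_mul_pow (hm : Even m) (hm0 : 0 < m) (hT : 0 < T) (l : ℕ) :
    ∫ a : ℝ, a ^ (2 * l) * Real.exp (-T * a ^ m) =
      2 * (T ^ (-(2 * l + 1 : ℝ) / m) * (1 / m) * Real.Gamma ((2 * l + 1) / m)) := by
  have h1 := integral_comp_abs (f := fun a : ℝ => a ^ (2 * l) * Real.exp (-T * a ^ m))
  simp only [(even_two_mul l).pow_abs, hm.pow_abs] at h1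
  rw [h1]
  have h2 := integral_rpow_mul_exp_neg_mul_rpow (p := (m : ℝ)) (q := ((2 * l : ℕ) : ℝ))
    (Nat.cast_pos.2 hm0) (lt_of_lt_of_le (by norm_num) (Nat.cast_nonneg _)) hT
  simp only [Real.rpow_natCast] at h2
  rw [h2]
  push_cast
  rfl

lemma integrable_cosh_mul_exp_neg_mul_pow (hm : Even m) (hm0 : 0 < m) (hT : 0 < T) (d : ℝ) :
    Integrable fun a : ℝ => Real.cosh (d * a) * Real.exp (-T * a ^ m) := by
  have hb : 0 < T / 2 := half_pos hT
  refine ((integrable_exp_neg_mul_sq hb).const_mul (Real.exp (T + d ^ 2 / (2 * T)))).mono'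
    (by have := Real.continuous_cosh; fun_prop) (ae_of_all _ fun a => ?_)
  rw [Real.norm_of_nonneg (mul_nonneg (Real.cosh_pos _).le (Real.exp_pos _).le)]
  -- Young's inequality `|d a| ≤ d²/(2T) + T a²/2` spends only half of the Gaussian decay rate `T`.
  have hc : Real.cosh (d * a) ≤ Real.exp (d ^ 2 / (2 * T) + T / 2 * a ^ 2) := by
    have key (x : ℝ) (hx : x = d * a ∨ x = -(d * a)) :
        Real.exp x ≤ Real.exp (d ^ 2 / (2 * T) + T / 2 * a ^ 2) := by
      apply Real.exp_le_exp.2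
      have h : d ^ 2 / (2 * T) + T / 2 * a ^ 2 = (d ^ 2 + (T * a) ^ 2) / (2 * T) := by
        field_simp
      rw [h, le_div_iff₀ (by positivity)]
      rcases hx with rfl | rfl
      · nlinarith [sq_nonneg (d - T * a)]
      · nlinarith [sq_nonneg (d + T * a)]
    rw [Real.cosh_eq]
    linarith [key _ (Or.inl rfl), key _ (Or.inr rfl)]
  calc _ ≤ Real.exp (d ^ 2 / (2 * T) + T / 2 * a ^ 2) * (Real.exp T * Real.exp (-T * a ^ 2)) := by
        gcongr
        exact exp_neg_mul_pow_le hm hm0 hT a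
    _ = _ := by
        rw [← Real.exp_add, ← Real.exp_add, ← Real.exp_add]
        ring_nf

/-- The absolute values of the cosine terms sum to `cosh`, which is integrable against the symbol;
dominated convergence then permits termwise integration. -/
lemma hasSum_integral_cos_mul_exp (hm : Even m) (hm0 : 0 < m) (hT : 0 < T) (d : ℝ) :
    HasSum (fun l : ℕ => ∫ a : ℝ, (-1) ^ l * (d * a) ^ (2 * l) / ((2 * l).factorial : ℝ) *
      Real.exp (-T * a ^ m)) (∫ a : ℝ, Real.cos (d * a) * Real.exp (-T * a ^ m)) := by
  have hs (a : ℝ) := (Real.hasSum_cosh (d * a)).mul_right (Real.exp (-T * a ^ m))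
  refine hasSum_integral_of_dominated_convergence
    (fun l a => (d * a) ^ (2 * l) / ((2 * l).factorial : ℝ) * Real.exp (-T * a ^ m))
    (fun l => Continuous.aestronglyMeasurable (by fun_prop))
    (fun l => ae_of_all _ fun a => ?_) (ae_of_all _ fun a => (hs a).summable) ?_
    (ae_of_all _ fun a => (Real.hasSum_cos (d * a)).mul_right _)
  · rw [norm_mul, norm_div, norm_mul, norm_pow, norm_neg, norm_one, one_pow, one_mul,
      Real.norm_of_nonneg ((even_two_mul l).pow_nonneg _), Real.norm_of_nonneg (Nat.cast_nonneg _),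
      Real.norm_of_nonneg (Real.exp_pos _).le]
  · simp_rw [fun a => (hs a).tsum_eq]
    exact integrable_cosh_mul_exp_neg_mul_pow hm hm0 hT d

lemma integral_cos_term_eq_foxWrightTerm (hm : Even m) (hm0 : 0 < m) (hT : 0 < T) (d : ℝ) (l : ℕ) :
    ∫ a : ℝ, (-1) ^ l * (d * a) ^ (2 * l) / ((2 * l).factorial : ℝ) * Real.exp (-T * a ^ m) =
      2 * √Real.pi / (m * T ^ (1 / (m : ℝ))) *
        foxWrightTerm ![1 / (m : ℝ)] ![2 / (m : ℝ)] ![1 / 2] ![1]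
          (-d ^ 2 / (4 * T ^ (2 / (m : ℝ)))) l := by
  have e : ∀ a : ℝ, (-1) ^ l * (d * a) ^ (2 * l) / ((2 * l).factorial : ℝ) * Real.exp (-T * a ^ m) =
      ((-1) ^ l * d ^ (2 * l) / ((2 * l).factorial : ℝ)) *
        (a ^ (2 * l) * Real.exp (-T * a ^ m)) := by
    intro a; rw [mul_pow]; ring
  simp_rw [e]
  rw [integral_const_mul, integral_pow_mul_exp_neg_mul_pow hm hm0 hT]
  have hm' : (m : ℝ) ≠ 0 := Nat.cast_ne_zero.2 hm0.ne'
  have h1 : T ^ (-(2 * l + 1 : ℝ) / m) = (T ^ (1 / (m : ℝ)))⁻¹ * ((T ^ (2 / (m : ℝ))) ^ l)⁻¹ := by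
    rw [← Real.rpow_natCast, ← Real.rpow_mul hT.le, ← Real.rpow_neg hT.le, ← Real.rpow_neg hT.le,
      ← Real.rpow_add hT]
    congr 1
    field_simp
    ring
  have h2 : (1 / (m : ℝ)) + 2 / m * l = (2 * l + 1) / m := by field_simp; ring
  have h3 := factorial_two_mul_mul_sqrt_pi l
  have hG : Real.Gamma (1 / 2 + l) ≠ 0 := (Real.Gamma_pos_of_pos (by positivity)).ne'
  have hf : ((2 * l).factorial : ℝ) ≠ 0 := Nat.cast_ne_zero.2 (Nat.factorial_ne_zero _)
  have hf' : (l.factorial : ℝ) ≠ 0 := Nat.cast_ne_zero.2 (Nat.factorial_ne_zero _)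
  have hT1 : T ^ (1 / (m : ℝ)) ≠ 0 := by positivity
  have hT2 : T ^ (2 / (m : ℝ)) ≠ 0 := by positivity
  have h4 : √Real.pi / (Real.Gamma (1 / 2 + l) * (4 ^ l * l.factorial)) =
      1 / ((2 * l).factorial : ℝ) := by
    rw [div_eq_div_iff (by positivity) hf]
    linear_combination h3
  simp only [foxWrightTerm, Finset.univ_unique, Fin.default_eq_zero, Finset.prod_singleton,
    Matrix.cons_val_fin_one, one_mul]
  rw [h1, h2, neg_div, neg_pow (d ^ 2 / _), div_pow, mul_pow, ← pow_mul]
  linear_combination (-(2 * (T ^ (1 / (m : ℝ)))⁻¹ * ((T ^ (2 / (m : ℝ))) ^ l)⁻¹ * (1 / (m : ℝ)) *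
    Real.Gamma ((2 * l + 1) / m) * (-1) ^ l * d ^ (2 * l))) * h4

/-- Inherited from the termwise integration, since the terms agree up to a nonzero constant; no
ratio test is needed. -/
lemma summable_foxWrightTerm (hm : Even m) (hm0 : 0 < m) (hT : 0 < T) (d : ℝ) :
    Summable (foxWrightTerm ![1 / (m : ℝ)] ![2 / (m : ℝ)] ![1 / 2] ![1]
      (-d ^ 2 / (4 * T ^ (2 / (m : ℝ))))) := by
  have h := (hasSum_integral_cos_mul_exp hm hm0 hT d).summable
  simp_rw [integral_cos_term_eq_foxWrightTerm hm hm0 hT d] at h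
  refine (summable_mul_left_iff ?_).1 h
  have : (m : ℝ) ≠ 0 := Nat.cast_ne_zero.2 hm0.ne'
  positivity

lemma integral_cos_mul_exp_eq_foxWright (hm : Even m) (hm0 : 0 < m) (hT : 0 < T) (d : ℝ) :
    ∫ a : ℝ, Real.cos (d * a) * Real.exp (-T * a ^ m) =
      2 * √Real.pi / (m * T ^ (1 / (m : ℝ))) *
        foxWright ![1 / (m : ℝ)] ![2 / (m : ℝ)] ![1 / 2] ![1]
          (-d ^ 2 / (4 * T ^ (2 / (m : ℝ)))) := by
  have h := hasSum_integral_cos_mul_exp hm hm0 hT d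
  simp_rw [integral_cos_term_eq_foxWrightTerm hm hm0 hT d] at h
  rw [← h.tsum_eq, tsum_mul_left, foxWright]

end FoxWright
-- Centring the initial data and the solution.
section RandomFields

variable {Ω : Type*} [MeasurableSpace Ω] {P : Measure Ω}

lemma cov_eq_inner {V V' : Lp ℝ 2 P} (hV : ∫ ω, V ω ∂P = 0) (hV' : ∫ ω, V' ω ∂P = 0)
    {X X' : Ω → ℝ} (hX : X =ᵐ[P] V) (hX' : X' =ᵐ[P] V') : cov[X, X'; P] = inner ℝ V V' := by
  rw [covariance, integral_congr_ae hX, integral_congr_ae hX', hV, hV', L2.inner_def]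
  refine integral_congr_ae ?_
  filter_upwards [hX, hX'] with ω h h'
  simp [h, h', mul_comm]

lemma continuous_cyclicCov {n : ℕ} {κ w A : Fin n → ℝ} : Continuous (cyclicCov κ w A) := by
  refine continuous_finsetSum _ fun j _ => Continuous.mul (Continuous.div (by fun_prop) ?_ ?_)
    continuous_const
  · exact Continuous.rpow_const (by fun_prop) fun x => Or.inl (by positivity)
  · intro x; positivity

variable [IsProbabilityMeasure P]

lemma isStationaryGaussian_sub_mean {η : ℝ → Ω → ℝ} {r : ℝ → ℝ}
    (hη_meas : Measurable (fun p : ℝ × Ω => η p.1 p.2)) (hη_gauss : IsGaussianProcess η P)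
    (hη_cov : ∀ y x : ℝ, cov[η y, η (y + x); P] = r x) (hr : Continuous r) :
    IsStationaryGaussian (fun y ω => η y ω - ∫ ω', η y ω' ∂P) r P where
  measurable := by
    have hM : Measurable fun y => ∫ ω, η y ω ∂P :=
      (StronglyMeasurable.integral_prod_right (f := fun y ω => η y ω)
        hη_meas.stronglyMeasurable).measurable
    exact hη_meas.sub (hM.comp measurable_fst)
  gaussian := by
    refine ⟨fun I => ?_⟩
    have h := hη_gauss.hasGaussianLaw I
    have hg := h.isGaussian_map
    refine ⟨?_⟩
    have e : (fun ω => I.restrict fun y => η y ω - ∫ ω', η y ω' ∂P) =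
        (fun x => x + fun y : I => -∫ ω', η y ω' ∂P) ∘ fun ω => I.restrict (η · ω) := by
      funext ω y
      simp [sub_eq_add_neg]
    rw [e, ← AEMeasurable.map_map_of_aemeasurable (by fun_prop) h.aemeasurable]
    infer_instance
  mean_zero y := by
    rw [integral_sub (hη_gauss.hasGaussianLaw_eval y).integrable (integrable_const _)]
    simp
  covariance y y' := by
    rw [← hη_cov y (y' - y), add_sub_cancel, covariance]
  continuous := hr

section Solution

variable {η : ℝ → Ω → ℝ} {r : ℝ → ℝ} {m : ℕ} {t x : ℝ}

lemma integrable_prod_solution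
    (h : IsStationaryGaussian (fun y ω => η y ω - ∫ ω', η y ω' ∂P) r P)
    (hk : Integrable (heatKernel m t))
    (hmean : Integrable (fun y : ℝ => (∫ ω, η (x - y) ω ∂P) * heatKernel m t y)) :
    Integrable (fun p : Ω × ℝ => η (x - p.2) p.1 * heatKernel m t p.2) (P.prod volume) := by
  refine ((h.integrable_prod hk x).add (hmean.comp_snd P)).congr (ae_of_all _ fun p => ?_)
  simp only [Pi.add_apply]
  ring

/-- The mean contributes only a deterministic term, which the centring in `rescaled` cancels. -/
lemma solution_ae_eq (h : IsStationaryGaussian (fun y ω => η y ω - ∫ ω', η y ω' ∂P) r P)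
    (hk : Integrable (heatKernel m t))
    (hmean : Integrable (fun y : ℝ => (∫ ω, η (x - y) ω ∂P) * heatKernel m t y)) :
    solution m η t x =ᵐ[P] fun ω => h.convolution (heatKernel m t) x ω +
      ∫ y, (∫ ω', η (x - y) ω' ∂P) * heatKernel m t y := by
  filter_upwards [h.integral_ae_eq_convolution hk x,
    (h.integrable_prod hk x).prod_right_ae] with ω h1 h2
  rw [← h1, ← integral_add h2 hmean, solution]
  refine integral_congr_ae (ae_of_all _ fun y => ?_)
  simp only
  ring

lemma solution_sub_mean_ae_eq
    (h : IsStationaryGaussian (fun y ω => η y ω - ∫ ω', η y ω' ∂P) r P)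
    (hk : Integrable (heatKernel m t))
    (hmean : Integrable (fun y : ℝ => (∫ ω, η (x - y) ω ∂P) * heatKernel m t y))
    (h0 : ∫ ω, h.convolution (heatKernel m t) x ω ∂P = 0) :
    (fun ω => solution m η t x ω - ∫ ω', solution m η t x ω' ∂P) =ᵐ[P]
      h.convolution (heatKernel m t) x := by
  have hs := solution_ae_eq h hk hmean
  filter_upwards [hs] with ω hω
  rw [integral_congr_ae hs, integral_add ((Lp.memLp _).integrable one_le_two) (integrable_const _),
    h0, hω]
  simp

lemma measurable_solution (hη_meas : Measurable (fun p : ℝ × Ω => η p.1 p.2)) :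
    Measurable (solution m η t x) := by
  refine StronglyMeasurable.measurable (StronglyMeasurable.integral_prod_right
    (f := fun (ω : Ω) (y : ℝ) => η (x - y) ω * heatKernel m t y) ?_)
  refine Measurable.stronglyMeasurable (Measurable.mul ?_
    (measurable_heatKernel.comp measurable_snd))
  exact hη_meas.comp ((measurable_const.sub measurable_snd).prodMk measurable_fst)

end Solution

end RandomFields

/-! ### The limit field: existence, Gaussianity, covariance. -/

section LimitField

variable {m : ℕ} {t t' x x' : ℝ}

lemma limitKernel_eq (l : ℝ) : limitKernel m t x l =
    Complex.exp (Complex.I * x * l) * ((Real.exp (-t * l ^ m) : ℝ) : ℂ) := by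
  rw [limitKernel, Complex.ofReal_exp, ← Complex.exp_add]
  congr 1
  push_cast; ring

lemma limitKernel_neg (hm : Even m) (l : ℝ) :
    limitKernel m t x (-l) = (starRingEnd ℂ) (limitKernel m t x l) := by
  rw [limitKernel_eq, limitKernel_eq, map_mul, Complex.conj_ofReal, ← Complex.exp_conj, hm.neg_pow]
  simp

lemma memLp_limitKernel (hm : Even m) (hm0 : 0 < m) (ht : 0 < t) :
    MemLp (limitKernel m t x) 2 volume := by
  have hc : Continuous (limitKernel m t x) := by unfold limitKernel; fun_prop
  rw [memLp_two_iff_integrable_sq_norm hc.aestronglyMeasurable]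
  refine (integrable_exp_neg_mul_pow hm hm0 (t := t + t) (by positivity)).congr
    (ae_of_all _ fun l => ?_)
  simp only
  rw [limitKernel_eq, norm_mul, norm_exp_I_mul_mul, one_mul, Complex.norm_real, Real.norm_eq_abs,
    Real.abs_exp, ← Real.exp_nat_mul]
  congr 1
  push_cast; ring

lemma integral_limitKernel_mul_conj (hm : Even m) (hm0 : 0 < m) (ht : 0 < t) (ht' : 0 < t') :
    (∫ l, limitKernel m t' x' l * (starRingEnd ℂ) (limitKernel m t x l)).re =
      ∫ l : ℝ, Real.cos (l * (x - x')) * Real.exp (-(t + t') * l ^ m) := by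
  have e (l : ℝ) : limitKernel m t' x' l * (starRingEnd ℂ) (limitKernel m t x l) =
      Complex.exp (Complex.I * ((x' - x : ℝ) : ℂ) * l) *
        ((Real.exp (-(t + t') * l ^ m) : ℝ) : ℂ) := by
    rw [← limitKernel_neg hm, limitKernel, limitKernel, Complex.ofReal_exp, ← Complex.exp_add,
      ← Complex.exp_add, Complex.ofReal_neg, hm.neg_pow]
    congr 1
    push_cast; ring
  simp_rw [e]
  have hi := integrable_exp_mul (integrable_exp_neg_mul_pow hm hm0 (add_pos ht ht')).ofReal (x' - x)
  refine (integral_re hi).symm.trans (integral_congr_ae (ae_of_all _ fun l => ?_))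
  have e1 : Complex.I * ((x' - x : ℝ) : ℂ) * l = ((-(l * (x - x')) : ℝ) : ℂ) * Complex.I := by
    push_cast; ring
  simp only [RCLike.re_eq_complex_re]
  erw [Complex.re_mul_ofReal]
  rw [e1, Complex.exp_ofReal_mul_I_re, Real.cos_neg]
  rfl

variable {Ω : Type*} [MeasurableSpace Ω] {P : Measure Ω} {W : Set ℝ → Ω → ℂ}

lemma IsSymmetricWhiteNoise.isStochInt_limitKernel (hW : IsSymmetricWhiteNoise W P) (hm : Even m)
    (hm0 : 0 < m) (ht : 0 < t) (x : ℝ) :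
    IsStochInt W P (limitKernel m t x) (stochInt W P (limitKernel m t x)) := by
  have h := hW.isOrthogonalFamily.exists_isStochInt (memLp_limitKernel (x := x) hm hm0 ht)
  rw [stochInt, dif_pos h]
  exact h.choose_spec

lemma IsSymmetricWhiteNoise.exists_limitField (hW : IsSymmetricWhiteNoise W P) (hm : Even m)
    (hm0 : 0 < m) (ht : 0 < t) (σ x : ℝ) :
    ∃ V ∈ closedSpan (realParts W P), limitField m σ W P t x =ᵐ[P] V := by
  have hX := hW.isStochInt_limitKernel hm hm0 ht x
  refine ⟨√σ • reLp P (hW.isOrthogonalFamily.memLp_of_isStochInt hX).toLp,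
    Submodule.smul_mem _ _ (hW.reLp_mem (memLp_limitKernel hm hm0 ht) hX), ?_⟩
  filter_upwards [Lp.coeFn_smul (√σ) (reLp P (hW.isOrthogonalFamily.memLp_of_isStochInt hX).toLp),
    coeFn_reLp (hW.isOrthogonalFamily.memLp_of_isStochInt hX).toLp,
    (hW.isOrthogonalFamily.memLp_of_isStochInt hX).coeFn_toLp] with ω h1 h2 h3
  rw [h1, Pi.smul_apply, h2, h3, limitField, smul_eq_mul]

variable [IsProbabilityMeasure P]

lemma IsSymmetricWhiteNoise.integral_limitField (hW : IsSymmetricWhiteNoise W P) (hm : Even m)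
    (hm0 : 0 < m) (ht : 0 < t) (σ x : ℝ) : ∫ ω, limitField m σ W P t x ω ∂P = 0 := by
  obtain ⟨V, hV, h⟩ := hW.exists_limitField hm hm0 ht σ x
  rw [integral_congr_ae h, (hW.isCenteredGaussian V hV).integral_eq_zero]

lemma IsSymmetricWhiteNoise.cov_limitField (hW : IsSymmetricWhiteNoise W P) (hm : Even m)
    (hm0 : 0 < m) (ht : 0 < t) (ht' : 0 < t') {σ : ℝ} (hσ : 0 ≤ σ) (x x' : ℝ) :
    cov[limitField m σ W P t x, limitField m σ W P t' x'; P] =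
      σ * ∫ l : ℝ, Real.cos (l * (x - x')) * Real.exp (-(t + t') * l ^ m) := by
  rw [ProbabilityTheory.covariance, hW.integral_limitField hm hm0 ht,
    hW.integral_limitField hm hm0 ht',
    ← integral_limitKernel_mul_conj hm hm0 ht ht', ← hW.integral_re_mul_re
      (memLp_limitKernel hm hm0 ht) (memLp_limitKernel hm hm0 ht') (limitKernel_neg hm)
      (hW.isStochInt_limitKernel hm hm0 ht x) (hW.isStochInt_limitKernel hm hm0 ht' x'),
    ← integral_const_mul]
  refine integral_congr_ae (ae_of_all _ fun ω => ?_)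
  simp only [limitField, sub_zero]
  rw [mul_mul_mul_comm, Real.mul_self_sqrt hσ]

lemma IsSymmetricWhiteNoise.isGaussianProcess_limitField (hW : IsSymmetricWhiteNoise W P)
    (hm : Even m) (hm0 : 0 < m) (σ : ℝ) :
    IsGaussianProcess (fun (p : {p : ℝ × ℝ // 0 < p.1}) (ω : Ω) =>
      limitField m σ W P p.1.1 p.1.2 ω) P := by
  choose V hV h using fun p : {p : ℝ × ℝ // 0 < p.1} => hW.exists_limitField hm hm0 p.2 σ p.1.2
  exact isGaussianProcess_of_mem hW.isCenteredGaussian hV h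

end LimitField

/-! ### Covariances of the rescaled field. -/

section Rescaled

variable {Ω : Type*} [MeasurableSpace Ω] {P : Measure Ω} [IsProbabilityMeasure P]
  {η : ℝ → Ω → ℝ} {r f : ℝ → ℝ} {m : ℕ}

lemma rescaled_ae_eq (h : IsStationaryGaussian (fun y ω => η y ω - ∫ ω', η y ω' ∂P) r P)
    (hm : Even m) (hm0 : 0 < m)
    (hη_mean : ∀ t x : ℝ, 0 < t →
      Integrable (fun y : ℝ => (∫ ω, η (x - y) ω ∂P) * heatKernel m t y))
    {ε t : ℝ} (hε : 0 < ε) (ht : 0 < t) (x : ℝ)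
    (hH : ∀ X ∈ closedSpan h.curve, IsCenteredGaussian X) :
    rescaled m η P ε t x =ᵐ[P]
      (ε ^ (-(1 / 4) : ℝ) • h.convolution (heatKernel m (t / √(ε ^ m))) (x / √ε) : Lp ℝ 2 P) := by
  have ht' : 0 < t / √(ε ^ m) := by positivity
  have hk := integrable_heatKernel hm hm0 ht'
  have h0 := (hH _ (h.convolution_mem hk (x / √ε))).integral_eq_zero
  filter_upwards [solution_sub_mean_ae_eq h hk (hη_mean _ (x / √ε) ht') h0,
    Lp.coeFn_smul (ε ^ (-(1 / 4) : ℝ)) (h.convolution (heatKernel m (t / √(ε ^ m))) (x / √ε))]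
    with ω h1 h2
  rw [h2, Pi.smul_apply, ← h1, rescaled, smul_eq_mul]

lemma tendsto_cov_rescaled (h : IsStationaryGaussian (fun y ω => η y ω - ∫ ω', η y ω' ∂P) r P)
    (hm : Even m) (hm0 : 0 < m)
    (hη_mean : ∀ t x : ℝ, 0 < t →
      Integrable (fun y : ℝ => (∫ ω, η (x - y) ω ∂P) * heatKernel m t y))
    (hH : ∀ X ∈ closedSpan h.curve, IsCenteredGaussian X)
    (hf : Integrable f) (hc : ContinuousAt f 0)
    (hr : ∀ x : ℝ, ∫ l : ℝ, Complex.exp (Complex.I * x * l) * (f l : ℂ) = (r x : ℂ))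
    {t t' : ℝ} (ht : 0 < t) (ht' : 0 < t') (x x' : ℝ) :
    Tendsto (fun ε => cov[rescaled m η P ε t x, rescaled m η P ε t' x'; P]) (𝓝[>] (0 : ℝ))
      (𝓝 (f 0 * ∫ l : ℝ, Real.cos (l * (x - x')) * Real.exp (-(t + t') * l ^ m))) := by
  have hlim := tendsto_scaled_integral hm hm0 (add_pos ht ht') hf hc (x' - x)
  -- The concentration parameter is `c = ε^(-1/2)`. Two normalising factors `ε^(-1/4)` produce the
  -- prefactor `c`, and the scalings of space and time replace `λ` by `c λ`.
  have hscale : Tendsto (fun ε : ℝ => (√ε)⁻¹) (𝓝[>] 0) atTop := by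
    refine tendsto_inv_nhdsGT_zero.comp ?_
    refine tendsto_nhdsWithin_iff.2 ⟨?_, ?_⟩
    · have := Real.continuous_sqrt.tendsto 0
      rw [Real.sqrt_zero] at this
      exact this.mono_left nhdsWithin_le_nhds
    · filter_upwards [self_mem_nhdsWithin] with ε hε using Real.sqrt_pos.2 hε
  have e : ∫ l : ℝ, Real.cos (l * (x - x')) * Real.exp (-(t + t') * l ^ m) =
      ∫ l : ℝ, Real.cos ((x' - x) * l) * Real.exp (-(t + t') * l ^ m) := by
    refine integral_congr_ae (ae_of_all _ fun l => ?_)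
    simp only
    rw [← Real.cos_neg]
    congr 2
    ring
  rw [e]
  refine (hlim.comp hscale).congr' ?_
  filter_upwards [self_mem_nhdsWithin] with ε hε
  have hε : 0 < ε := hε
  have hs : 0 < t / √(ε ^ m) := by positivity
  have hs' : 0 < t' / √(ε ^ m) := by positivity
  have hmem (s y : ℝ) (hs : 0 < s) : ∫ ω, (ε ^ (-(1 / 4) : ℝ) • h.convolution (heatKernel m s) y :
      Lp ℝ 2 P) ω ∂P = 0 :=
    (hH _ (Submodule.smul_mem _ _ (h.convolution_mem (integrable_heatKernel hm hm0 hs)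
      y))).integral_eq_zero
  rw [cov_eq_inner (hmem _ _ hs) (hmem _ _ hs') (rescaled_ae_eq h hm hm0 hη_mean hε ht x hH)
    (rescaled_ae_eq h hm hm0 hη_mean hε ht' x' hH), inner_smul_left, inner_smul_right,
    h.inner_convolution (integrable_heatKernel hm hm0 hs) (integrable_heatKernel hm hm0 hs'),
    integral_heatKernel_mul_heatKernel hm hm0 hs hs' hf hr, ← mul_assoc]
  have e1 : ε ^ (-(1 / 4) : ℝ) * ε ^ (-(1 / 4) : ℝ) = (√ε)⁻¹ := by
    rw [← Real.rpow_add hε, Real.sqrt_eq_rpow, ← Real.rpow_neg hε.le]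
    norm_num
  have e2 : √(ε ^ m) = √ε ^ m := by
    rw [Real.sqrt_eq_iff_eq_sq (by positivity) (by positivity), ← pow_mul, mul_comm, pow_mul,
      Real.sq_sqrt hε.le]
  simp only [conj_trivial]
  rw [e1, e2, Function.comp]
  congr 1
  refine integral_congr_ae (ae_of_all _ fun l => ?_)
  have hsq : √ε ≠ 0 := by positivity
  simp only
  congr 3
  · field_simp
  · rw [mul_pow, inv_pow]
    field_simp

end Rescaled

end HighOrderHeat

theorem theorem3p1
    -- the order of the equation
    (m : ℕ) (hm_even : Even m) (hm_pos : 0 < m)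
    -- the parameters of the covariance function
    {n : ℕ} (κ w A : Fin n → ℝ)
    (hκ : ∀ j, κ j ∈ Set.Ioo (0 : ℝ) 1) (hw : ∀ j, w j ≠ 0) (hA : ∑ j, A j = 1)
    -- the random initial condition
    {Ω : Type*} [MeasurableSpace Ω] (P : Measure Ω) [IsProbabilityMeasure P]
    (η : ℝ → Ω → ℝ)
    (hη_meas : Measurable (fun p : ℝ × Ω => η p.1 p.2))
    (hη_gauss : IsGaussianProcess η P)
    (hη_cov : ∀ y x : ℝ, cov[η y, η (y + x); P] = cyclicCov κ w A x)
    -- the convolution of the mean of the initial condition with the fundamental solution exists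
    (hη_mean : ∀ t x : ℝ, 0 < t →
      Integrable (fun y : ℝ => (∫ ω, η (x - y) ω ∂P) * heatKernel m t y))
    -- the white noise of the limit field
    {Ω' : Type*} [MeasurableSpace Ω'] (P' : Measure Ω') [IsProbabilityMeasure P']
    (W : Set ℝ → Ω' → ℂ) (hW : IsSymmetricWhiteNoise W P') :
    -- the solution field and its mean are well defined
    (∀ t x : ℝ, 0 < t →
      (∀ᵐ ω ∂P, Integrable (fun y : ℝ => η (x - y) ω * heatKernel m t y)) ∧
      Integrable (solution m η t x) P) ∧
    -- the stochastic integrals of the limit field exist and are real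
    (∀ t x : ℝ, 0 < t →
      IsStochInt W P' (limitKernel m t x) (stochInt W P' (limitKernel m t x)) ∧
      ∀ᵐ ω ∂P', (stochInt W P' (limitKernel m t x) ω).im = 0) ∧
    -- convergence of the finite-dimensional distributions
    (∀ (N : ℕ) (p : Fin N → ℝ × ℝ), (∀ i, 0 < (p i).1) →
      TendstoInDistribution
        (fun (ε : ℝ) (ω : Ω) (i : Fin N) => rescaled m η P ε (p i).1 (p i).2 ω)
        (𝓝[>] (0 : ℝ))
        (fun (ω : Ω') (i : Fin N) =>
          limitField m (spectralAtZero κ w A) W P' (p i).1 (p i).2 ω)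
        (fun _ => P) P') ∧
    -- the limit field is Gaussian with zero mean
    IsGaussianProcess
      (fun (p : {p : ℝ × ℝ // 0 < p.1}) (ω : Ω') =>
        limitField m (spectralAtZero κ w A) W P' p.1.1 p.1.2 ω) P' ∧
    (∀ t x : ℝ, 0 < t → ∫ ω, limitField m (spectralAtZero κ w A) W P' t x ω ∂P' = 0) ∧
    -- the covariance function of the limit field
    (∀ t t' x x' : ℝ, 0 < t → 0 < t' →
      cov[limitField m (spectralAtZero κ w A) W P' t x,
          limitField m (spectralAtZero κ w A) W P' t' x'; P'] =
        spectralAtZero κ w A *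
          ∫ l : ℝ, Real.cos (l * (x - x')) * Real.exp (-(t + t') * l ^ m) ∧
      Summable (foxWrightTerm ![1 / (m : ℝ)] ![2 / (m : ℝ)] ![1 / 2] ![1]
        (-(x - x') ^ 2 / (4 * (t + t') ^ (2 / (m : ℝ))))) ∧
      cov[limitField m (spectralAtZero κ w A) W P' t x,
          limitField m (spectralAtZero κ w A) W P' t' x'; P'] =
        spectralAtZero κ w A *
          (2 * √Real.pi / (m * (t + t') ^ (1 / (m : ℝ))) *
            foxWright ![1 / (m : ℝ)] ![2 / (m : ℝ)] ![1 / 2] ![1]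
              (-(x - x') ^ 2 / (4 * (t + t') ^ (2 / (m : ℝ)))))) := by
  have hκ0 : ∀ j, 0 < κ j := fun j => (hκ j).1
  have hst := isStationaryGaussian_sub_mean hη_meas hη_gauss hη_cov continuous_cyclicCov
  have hH : ∀ X ∈ closedSpan hst.curve, IsCenteredGaussian X := fun X hX =>
    isCenteredGaussian_of_mem_closedSpan
      (hst.gaussian.congr fun y => (hst.memLp y).coeFn_toLp.symm)
      (fun y => (integral_congr_ae (hst.memLp y).coeFn_toLp).trans (hst.mean_zero y)) hX
  have hf : Integrable (spectralDensity κ w A) := integrable_spectralDensity hκ0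
  have hf0 : ContinuousAt (spectralDensity κ w A) 0 := continuousAt_spectralDensity_zero hκ0 hw
  have hcov {t t' : ℝ} (ht : 0 < t) (ht' : 0 < t') (x x' : ℝ) :
      Tendsto (fun ε => cov[rescaled m η P ε t x, rescaled m η P ε t' x'; P]) (𝓝[>] (0 : ℝ))
        (𝓝 (spectralAtZero κ w A *
          ∫ l : ℝ, Real.cos (l * (x - x')) * Real.exp (-(t + t') * l ^ m))) := by
    rw [← spectralDensity_zero hκ0 hw]
    exact tendsto_cov_rescaled hst hm_even hm_pos hη_mean hH hf hf0
      (integral_exp_mul_spectralDensity hκ0) ht ht' x x'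
  -- The weights `A j` may be negative, so the sign is not visible from the formula. It is read off
  -- a limit of variances at `t = 1`, `x = 0`, divided by the positive integral of the profile.
  have hσ : 0 ≤ spectralAtZero κ w A := by
    have h1 := hcov one_pos one_pos 0 0
    have h2 : 0 ≤ spectralAtZero κ w A *
        ∫ l : ℝ, Real.cos (l * (0 - 0)) * Real.exp (-(1 + 1) * l ^ m) := by
      refine ge_of_tendsto' h1 fun ε => ?_
      rw [covariance]
      exact integral_nonneg fun ω => mul_self_nonneg _
    simp only [sub_zero, mul_zero, Real.cos_zero, one_mul] at h2
    exact nonneg_of_mul_nonneg_left h2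
      (integral_exp_neg_mul_pow_pos hm_even hm_pos (by norm_num))
  have hlim {t t' : ℝ} (ht : 0 < t) (ht' : 0 < t') (x x' : ℝ) :=
    hW.cov_limitField hm_even hm_pos ht ht' hσ x x'
  have hgauss := hW.isGaussianProcess_limitField hm_even hm_pos (spectralAtZero κ w A)
  have hzero {t : ℝ} (ht : 0 < t) (x : ℝ) :=
    hW.integral_limitField hm_even hm_pos ht (spectralAtZero κ w A) x
  refine ⟨fun t x ht => ?_, fun t x ht => ?_, fun N p hp => ?_, hgauss,
    fun t x ht => hzero ht x, fun t t' x x' ht ht' => ?_⟩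
  · have hi := integrable_prod_solution hst (integrable_heatKernel hm_even hm_pos ht)
      (hη_mean t x ht)
    exact ⟨hi.prod_right_ae, hi.integral_prod_left⟩
  · have hX := hW.isStochInt_limitKernel hm_even hm_pos ht x
    exact ⟨hX, hW.im_eq_zero (memLp_limitKernel hm_even hm_pos ht) (limitKernel_neg hm_even) hX⟩
  · choose V hV hVeq using fun i =>
      hW.exists_limitField hm_even hm_pos (hp i) (spectralAtZero κ w A) (p i).2
    refine tendstoInDistribution_of_tendsto_cov (fun ε => ?_) ?_
      (hasGaussianLaw_pi_of_mem hW.isCenteredGaussian hV hVeq) (fun i => hzero (hp i) _)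
      fun i j => ?_
    -- Measurability is required for every real `ε`, including `ε ≤ 0`, whereas the Gaussian
    -- representation holds only for `ε > 0`.
    · exact (measurable_pi_lambda _ fun i =>
        ((measurable_solution hη_meas).sub_const _).const_mul _).aemeasurable
    · filter_upwards [self_mem_nhdsWithin] with ε hε
      have hε : 0 < ε := hε
      have hmem (i : Fin N) := Submodule.smul_mem (closedSpan hst.curve) (ε ^ (-(1 / 4) : ℝ))
        (hst.convolution_mem (integrable_heatKernel hm_even hm_pos
          (div_pos (hp i) (Real.sqrt_pos.2 (pow_pos hε m)))) ((p i).2 / √ε))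
      have hae (i : Fin N) := rescaled_ae_eq hst hm_even hm_pos hη_mean hε (hp i) (p i).2 hH
      refine ⟨hasGaussianLaw_pi_of_mem hH hmem hae, fun i => ?_⟩
      rw [integral_congr_ae (hae i), (hH _ (hmem i)).integral_eq_zero]
    · rw [hlim (hp i) (hp j)]
      exact hcov (hp i) (hp j) _ _
  · have hT := add_pos ht ht'
    refine ⟨hlim ht ht' x x', summable_foxWrightTerm hm_even hm_pos hT (x - x'), ?_⟩
    rw [hlim ht ht' x x', ← integral_cos_mul_exp_eq_foxWright hm_even hm_pos hT (x - x')]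
    simp only [mul_comm (x - x')]
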